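/- Let $b\ge 0$, $c\ge 0$, $a\ge 0$ be constants and let $n$ be a measure on $(0,\infty)$ with $\int_0^\infty (1\wedge u)\,n(du)<\infty$. For $z\ge 0$ put $$\phi(z)=bz+cz^2,\qquad \psi(z)=az+\int_0^\infty (1-e^{-zu})\,n(du),$$ and for $\lambda\ge 0$ let $t\mapsto v_t(\lambda)$ be the unique nonnegative solution on $[0,\infty)$ of $\frac{\partial}{\partial t}v_t(\lambda)=-\phi(v_t(\lambda))$, $v_0(\lambda)=\lambda$. Let $(P_t)_{t\ge0}$ be the transition semigroup on $[0,\infty)$ of the CBI-process (continuous-state branching process with immigration) with branching mechanism $\phi$ and immigration mechanism $\psi$, that is, $$\int_0^\infty e^{-\lambda y}P_t(x,dy)=\exp\Big\{-xv_t(\lambda)-\int_0^t\psi(v_s(\lambda))\,ds\Big\},\qquad t,x,\lambda\ge0.$$ Assume that $\phi(z)\ne0$ for all $z>0$ and that $\int_0^\lambda \frac{\psi(z)}{\phi(z)}\,dz<\infty$ for some $\lambda>0$. Let $\{Y_t:t\in\mathbb R\}$ be the stationary CBI-process with one-dimensional marginal distribution $\eta$, that is, $\eta$ is a probability measure on $[0,\infty)$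 and $\{Y_t\}$ is a $[0,\infty)$-valued stochastic process on a probability space such that, for all $t_1<t_2<\dots<t_m$ in $\mathbb R$ $(m\ge1)$, the law of $(Y_{t_1},\dots,Y_{t_m})$ is $$\eta(dx_1)\,P_{t_2-t_1}(x_1,dx_2)\cdots P_{t_m-t_{m-1}}(x_{m-1},dx_m).$$ (Necessarily $\eta$ is then the weak limit of $P_t(x,\cdot)$ as $t\to\infty$, for every $x\ge0$.) Then $\{Y_t\}$ is strongly mixing, i.e., as $t\to\infty$, $$\pi_t:=\sup_{A\in\sigma\{Y_s:\,s\le0\}}\ \sup_{B\in\sigma\{Y_s:\,s>t\}}\big|\mathbf P(A\cap B)-\mathbf P(A)\mathbf P(B)\big|\to0 .$$ -/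

import Mathlib

open MeasureTheory ProbabilityTheory Filter Topology
open scoped NNReal ENNReal

namespace CBI

/-- The branching mechanism `φ(z) = b z + c z²`. -/
noncomputable def branching (b c : ℝ) (z : ℝ) : ℝ := b * z + c * z ^ 2

/-- The immigration mechanism `ψ(z) = a z + ∫_{(0,∞)} (1 - e^{-zu}) n(du)`.
Only the restriction of `n` to `(0,∞)` matters. -/
noncomputable def immigration (a : ℝ) (n : Measure ℝ) (z : ℝ) : ℝ :=
  a * z + ∫ u in Set.Ioi (0 : ℝ), (1 - Real.exp (-(z * u))) ∂n

/-- The integral `∫_0^t e^{-bs} ds`, namely `(1 - e^{-bt}) / b` for `b ≠ 0` and `t` for `b = 0`. -/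
noncomputable def discount (b t : ℝ) : ℝ :=
  if b = 0 then t else (1 - Real.exp (-(b * t))) / b

/-- The function `v_t(l)`, that is, the unique nonnegative solution on `[0,∞)` of
`∂_t v_t(l) = -φ(v_t(l))`, `v_0(l) = l`, in closed form. The lemmas `cumulant_zero`,
`cumulant_nonneg`, `cumulant_hasDerivAt` and `cumulant_unique` below show that it is
indeed that solution. -/
noncomputable def cumulant (b c t l : ℝ) : ℝ :=
  Real.exp (-(b * t)) * l / (1 + c * l * discount b t)

theorem discount_nonneg (b : ℝ) {t : ℝ} (ht : 0 ≤ t) : 0 ≤ discount b t := by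
  unfold discount
  split_ifs with h
  · exact ht
  · rcases lt_or_gt_of_ne h with hb | hb
    · apply div_nonneg_of_nonpos _ hb.le
      have : 1 ≤ Real.exp (-(b * t)) := Real.one_le_exp (by nlinarith)
      linarith
    · apply div_nonneg _ hb.le
      have : Real.exp (-(b * t)) ≤ 1 := Real.exp_le_one_iff.2 (by nlinarith)
      linarith

theorem discount_hasDerivAt (b t : ℝ) :
    HasDerivAt (discount b) (Real.exp (-(b * t))) t := by
  by_cases h : b = 0
  · subst h
    have : discount 0 = fun t => t := by funext t; simp [discount]
    rw [this]
    simpa using hasDerivAt_id' t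
  · have : discount b = fun t => (1 - Real.exp (-(b * t))) / b := by
      funext t; simp [discount, h]
    rw [this]
    have h1 : HasDerivAt (fun t : ℝ => -(b * t)) (-(b * 1)) t :=
      ((hasDerivAt_id t).const_mul b).neg
    have h2 := (h1.exp.const_sub 1).div_const b
    refine h2.congr_deriv ?_
    rw [mul_one, mul_neg, neg_neg, mul_div_assoc, div_self h, mul_one]

theorem cumulant_zero (b c l : ℝ) : cumulant b c 0 l = l := by
  simp [cumulant, discount]

theorem cumulant_nonneg (b : ℝ) {c t l : ℝ} (hc : 0 ≤ c) (ht : 0 ≤ t) (hl : 0 ≤ l) :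
    0 ≤ cumulant b c t l := by
  have := discount_nonneg b ht
  unfold cumulant
  positivity

theorem cumulant_hasDerivAt (b : ℝ) {c t l : ℝ} (hc : 0 ≤ c) (ht : 0 ≤ t) (hl : 0 ≤ l) :
    HasDerivAt (fun s => cumulant b c s l) (-branching b c (cumulant b c t l)) t := by
  have hd := discount_nonneg b ht
  have hpos : 1 + c * l * discount b t ≠ 0 := by positivity
  have h1 : HasDerivAt (fun t : ℝ => -(b * t)) (-(b * 1)) t :=
    ((hasDerivAt_id t).const_mul b).neg
  have h2 := (h1.exp.mul_const l).fun_div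
    (((discount_hasDerivAt b t).const_mul (c * l)).const_add 1) hpos
  refine h2.congr_deriv ?_
  unfold branching cumulant
  field_simp
  ring

theorem cumulant_unique {b c l : ℝ} (hb : 0 ≤ b) (hc : 0 ≤ c) (hl : 0 ≤ l) (u : ℝ → ℝ)
    (hu : ∀ t, 0 ≤ t → 0 ≤ u t) (h0 : u 0 = l)
    (hd : ∀ t, 0 ≤ t → HasDerivWithinAt u (-branching b c (u t)) (Set.Ici 0) t) :
    ∀ t, 0 ≤ t → u t = cumulant b c t l := by
  have hD : ∀ t, 0 ≤ t → HasDerivWithinAt (fun s => (u s - cumulant b c s l) ^ 2)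
      (2 * (u t - cumulant b c t l) *
        (-branching b c (u t) - -branching b c (cumulant b c t l))) (Set.Ici 0) t := by
    intro t ht
    have := ((hd t ht).sub (cumulant_hasDerivAt b hc ht hl).hasDerivWithinAt).fun_pow 2
    simpa using this
  have hanti : AntitoneOn (fun s => (u s - cumulant b c s l) ^ 2) (Set.Ici 0) := by
    refine antitoneOn_of_hasDerivWithinAt_nonpos (convex_Ici 0)
      (f' := fun t => 2 * (u t - cumulant b c t l) *
        (-branching b c (u t) - -branching b c (cumulant b c t l)))
      (fun t ht => (hD t ht).continuousWithinAt)
      (fun t ht => (hD t (interior_subset ht)).mono interior_subset) ?_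
    intro t ht
    have ht0 : 0 ≤ t := interior_subset ht
    have e1 := hu t ht0
    have e2 := cumulant_nonneg b hc ht0 hl
    have : 2 * (u t - cumulant b c t l) *
        (-branching b c (u t) - -branching b c (cumulant b c t l)) =
        -(2 * (b + c * (u t + cumulant b c t l)) * (u t - cumulant b c t l) ^ 2) := by
      unfold branching; ring
    rw [this]
    have : 0 ≤ 2 * (b + c * (u t + cumulant b c t l)) * (u t - cumulant b c t l) ^ 2 := by
      positivity
    linarith
  intro t ht
  have h := hanti (Set.mem_Ici.2 le_rfl) (Set.mem_Ici.2 ht) ht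
  simp only [h0, cumulant_zero, sub_self] at h
  have : (u t - cumulant b c t l) ^ 2 = 0 :=
    le_antisymm (by simpa using h) (sq_nonneg _)
  exact sub_eq_zero.1 ((pow_eq_zero_iff two_ne_zero).1 this)

/-- `P` is the transition semigroup on `[0,∞)` of the CBI-process with branching mechanism
`φ(z) = b z + c z²` and immigration mechanism `ψ(z) = a z + ∫ (1 - e^{-zu}) n(du)`:
each `P_t` is a probability kernel and its Laplace transform is
`∫ e^{-l y} P_t(x, dy) = exp (-x v_t(l) - ∫_0^t ψ(v_s(l)) ds)`. (A probability measure on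
`[0,∞)` is determined by its Laplace transform, so this determines `P`; the semigroup
property is a consequence.) -/
structure IsTransitionSemigroup (b c a : ℝ) (n : Measure ℝ)
    (P : ℝ≥0 → Kernel ℝ≥0 ℝ≥0) : Prop where
  isMarkovKernel : ∀ t, IsMarkovKernel (P t)
  laplace : ∀ (t x l : ℝ≥0),
    ∫ y : ℝ≥0, Real.exp (-((l : ℝ) * (y : ℝ))) ∂(P t x) =
      Real.exp (-((x : ℝ) * cumulant b c t l)
        - ∫ s in (0 : ℝ)..(t : ℝ), immigration a n (cumulant b c s l))

/-- The measure `η(dx₀) P_{t₁-t₀}(x₀, dx₁) ⋯ P_{t_m-t_{m-1}}(x_{m-1}, dx_m)` on `[0,∞)^{m+1}`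
(meant for `t₀ < t₁ < ⋯ < t_m`), by recursion on `m`. -/
noncomputable def pathLaw (P : ℝ≥0 → Kernel ℝ≥0 ℝ≥0) (η : Measure ℝ≥0) :
    (m : ℕ) → (Fin (m + 1) → ℝ) → Measure (Fin (m + 1) → ℝ≥0)
  | 0, _ => η.map (fun x _ => x)
  | m + 1, t =>
      ((pathLaw P η m (fun i => t i.castSucc)) ⊗ₘ
        ((P (Real.toNNReal (t (Fin.last (m + 1)) - t (Fin.last m).castSucc))).comap
          (fun x : Fin (m + 1) → ℝ≥0 => x (Fin.last m)) (measurable_pi_apply _))).map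
        (fun p => (Fin.snoc p.1 p.2 : Fin (m + 2) → ℝ≥0))

/-- `Y = (Y_t)_{t ∈ ℝ}` is a stochastic process whose finite-dimensional distributions are
those given by the initial law `η` and the transition kernels `P`. -/
structure HasPathLaw {Ω : Type*} [MeasurableSpace Ω] (μ : Measure Ω)
    (P : ℝ≥0 → Kernel ℝ≥0 ℝ≥0) (η : Measure ℝ≥0) (Y : ℝ → Ω → ℝ≥0) : Prop where
  measurable : ∀ t, Measurable (Y t)
  map_eq : ∀ (m : ℕ) (t : Fin (m + 1) → ℝ), StrictMono t →
    μ.map (fun ω i => Y (t i) ω) = pathLaw P η m t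

/-- The σ-algebra `σ{Y_s : s ∈ I}`. -/
@[reducible] def sigmaOf {Ω : Type*} (Y : ℝ → Ω → ℝ≥0) (I : Set ℝ) : MeasurableSpace Ω :=
  ⨆ s ∈ I, MeasurableSpace.comap (Y s) inferInstance

/-- The mixing coefficient
`π_t = sup {|P(A ∩ B) - P(A) P(B)| : A ∈ σ{Y_s, s ≤ 0}, B ∈ σ{Y_s, s > t}}`.
For a probability measure the set is nonempty and bounded by `1`. -/
noncomputable def mixingCoeff {Ω : Type*} [MeasurableSpace Ω] (μ : Measure Ω)
    (Y : ℝ → Ω → ℝ≥0) (t : ℝ) : ℝ :=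
  sSup {r : ℝ | ∃ A B : Set Ω, MeasurableSet[sigmaOf Y (Set.Iic 0)] A ∧
    MeasurableSet[sigmaOf Y (Set.Ioi t)] B ∧ r = |μ.real (A ∩ B) - μ.real A * μ.real B|}

end CBI

/-! By the Markov property, the conditional probability of an event after time `t`, given the past
up to `0`, is `K(Y_0)` with `K(x) = ∫ h dP_t(x,·)` and `0 ≤ h ≤ 1`. Hence `|P(A ∩ B) - P(A)P(B)|` is
at most the mean of `|K(x) - K(y)|` over `η ⊗ η`, and by dominated convergence it suffices that
`P_t(x,·)` and `P_t(y,·)` merge in total variation for almost all `x, y` (`tendsto_mixingCoeff`).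

Total variation is read off from Laplace transforms at the integers. If `c_k = ∫ w^k dσ(w)` for a
signed measure `σ` on `[0,1]`, then `y^k ↦ c_k y^k` has norm at most `|σ|` on polynomials over
`[0,1]`. `IsMultiplier` keeps only this norm bound, which is stable under sums, products,
exponentials, integrals and limits. Applied to a difference of two Laplace transforms, it bounds the
total variation distance (`IsMultiplier.abs_integral_sub_le`).

If `c > 0`, then `x v_t(k) = r(1 - 1/(1 + kβ))` with `r ≤ x/(ct)`. The bracket is a multiplier of
norm at most `2`, so `exp(-x v_t(k)) - 1` has norm tending to `0` (`isMultiplier_of_pos`).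

If `c = 0`, then `b > 0`, and starting from `x` instead of `0` merely shifts the law by `x e^{-bt}`.
When `n` charges `(0,∞)`, immigration jumps of size at least `ε` smooth the law: a jump of age `r`
now weighs `e^{-br}u`, and integrating over `r` makes the shift harmless, except on the event of no
such jump with age in `(0,s]`, of probability `e^{-sm}` with `m` the mass that `n` gives to `[ε,∞)`
(`isMultiplier_of_linear`). When `n` vanishes there, nothing smooths the law, but `η` is a point
mass and almost surely `x = y` (`ae_eq_of_no_jumps`). -/

namespace CBI

/-! ### Coefficient multipliers of polynomials on `[0,1]`. -/

/-- The polynomial `∑ c_k p_k X^k` obtained from `p = ∑ p_k X^k`. -/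
noncomputable def scaleCoeff (c : ℕ → ℝ) (p : Polynomial ℝ) : Polynomial ℝ :=
  ∑ k ∈ Finset.range (p.natDegree + 1), Polynomial.monomial k (c k * p.coeff k)

theorem coeff_scaleCoeff (c : ℕ → ℝ) (p : Polynomial ℝ) (k : ℕ) :
    (scaleCoeff c p).coeff k = c k * p.coeff k := by
  unfold scaleCoeff
  rw [Polynomial.finsetSum_coeff]
  simp only [Polynomial.coeff_monomial]
  rw [Finset.sum_ite_eq']
  split_ifs with h
  · rfl
  · rw [Polynomial.coeff_eq_zero_of_natDegree_lt, mul_zero]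
    simpa [Nat.lt_succ_iff] using h

theorem eval_scaleCoeff (c : ℕ → ℝ) (p : Polynomial ℝ) (y : ℝ) :
    (scaleCoeff c p).eval y
      = ∑ k ∈ Finset.range (p.natDegree + 1), c k * p.coeff k * y ^ k := by
  unfold scaleCoeff
  rw [Polynomial.eval_finsetSum]
  simp only [Polynomial.eval_monomial]

theorem scaleCoeff_mul (c d : ℕ → ℝ) (p : Polynomial ℝ) :
    scaleCoeff (fun k => c k * d k) p = scaleCoeff c (scaleCoeff d p) := by
  ext k
  simp only [coeff_scaleCoeff, mul_assoc]

/-- The sequence `c` acts on polynomials, coefficient by coefficient, with norm at most `κ`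
for the supremum norm on `[0,1]`. -/
def IsMultiplier (c : ℕ → ℝ) (κ : ℝ) : Prop :=
  ∀ (p : Polynomial ℝ) (M : ℝ), (∀ y ∈ Set.Icc (0 : ℝ) 1, |p.eval y| ≤ M) →
    ∀ y ∈ Set.Icc (0 : ℝ) 1, |(scaleCoeff c p).eval y| ≤ κ * M

theorem nonneg_of_eval_le {p : Polynomial ℝ} {M : ℝ}
    (h : ∀ y ∈ Set.Icc (0 : ℝ) 1, |p.eval y| ≤ M) : 0 ≤ M :=
  (abs_nonneg _).trans (h 0 ⟨le_rfl, zero_le_one⟩)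

namespace IsMultiplier

variable {c d : ℕ → ℝ} {κ κ' : ℝ}

theorem mono (hc : IsMultiplier c κ) (h : κ ≤ κ') : IsMultiplier c κ' := fun p M hp y hy =>
  (hc p M hp y hy).trans (mul_le_mul_of_nonneg_right h (nonneg_of_eval_le hp))

theorem mul (hc : IsMultiplier c κ) (hd : IsMultiplier d κ') :
    IsMultiplier (fun k => c k * d k) (κ * κ') := fun p M hp y hy => by
  rw [scaleCoeff_mul, mul_assoc]
  exact hc _ _ (hd p M hp) y hy

theorem add (hc : IsMultiplier c κ) (hd : IsMultiplier d κ') :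
    IsMultiplier (fun k => c k + d k) (κ + κ') := fun p M hp y hy => by
  have : (scaleCoeff (fun k => c k + d k) p).eval y
      = (scaleCoeff c p).eval y + (scaleCoeff d p).eval y := by
    simp only [eval_scaleCoeff, ← Finset.sum_add_distrib, add_mul]
  rw [this, add_mul]
  exact (abs_add_le _ _).trans (add_le_add (hc p M hp y hy) (hd p M hp y hy))

theorem const_mul (hc : IsMultiplier c κ) (r : ℝ) :
    IsMultiplier (fun k => r * c k) (|r| * κ) := fun p M hp y hy => by
  have : (scaleCoeff (fun k => r * c k) p).eval y = r * (scaleCoeff c p).eval y := by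
    simp only [eval_scaleCoeff, Finset.mul_sum, mul_assoc]
  rw [this, abs_mul, mul_assoc]
  exact mul_le_mul_of_nonneg_left (hc p M hp y hy) (abs_nonneg r)

theorem neg (hc : IsMultiplier c κ) : IsMultiplier (fun k => -c k) κ := by
  simpa using hc.const_mul (-1)

theorem sub (hc : IsMultiplier c κ) (hd : IsMultiplier d κ') :
    IsMultiplier (fun k => c k - d k) (κ + κ') := by
  simpa only [sub_eq_add_neg] using hc.add hd.neg

/-- The action is the dilation `y ↦ wy`, which maps `[0,1]` into itself. All other multipliers are
built from these. -/
theorem geom {w : ℝ} (hw : w ∈ Set.Icc (0 : ℝ) 1) : IsMultiplier (fun k => w ^ k) 1 :=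
  fun p M hp y hy => by
  have : (scaleCoeff (fun k => w ^ k) p).eval y = p.eval (w * y) := by
    rw [eval_scaleCoeff, Polynomial.eval_eq_sum_range]
    refine Finset.sum_congr rfl fun k _ => ?_
    rw [mul_pow]; ring
  rw [this, one_mul]
  exact hp _ ⟨mul_nonneg hw.1 hy.1, mul_le_one₀ hw.2 hy.1 hy.2⟩

theorem one : IsMultiplier (fun _ => 1) 1 := by
  simpa using geom (w := 1) ⟨zero_le_one, le_rfl⟩

theorem pow (hc : IsMultiplier c κ) (m : ℕ) : IsMultiplier (fun k => c k ^ m) (κ ^ m) := by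
  induction m with
  | zero => simpa using one
  | succ m ih => simpa only [pow_succ] using ih.mul hc

/-- A fixed polynomial has finitely many coefficients, so convergence of each entry of the sequence
is enough. -/
theorem of_tendsto {ι : Type*} {l : Filter ι} [l.NeBot] {C : ι → ℕ → ℝ} {K : ι → ℝ}
    (hC : ∀ᶠ i in l, IsMultiplier (C i) (K i)) (hc : ∀ k, Tendsto (fun i => C i k) l (𝓝 (c k)))
    (hκ : Tendsto K l (𝓝 κ)) : IsMultiplier c κ := fun p M hp y hy => by
  have h : Tendsto (fun i => |(scaleCoeff (C i) p).eval y|) l (𝓝 |(scaleCoeff c p).eval y|) := by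
    simp only [eval_scaleCoeff]
    exact (tendsto_finsetSum _ fun k _ => ((hc k).mul_const _).mul_const _).abs
  exact le_of_tendsto_of_tendsto h (hκ.mul_const M) (hC.mono fun i hi => hi p M hp y hy)

theorem integral {X : Type*} [MeasurableSpace X] {ν : Measure X} [IsFiniteMeasure ν]
    {C : X → ℕ → ℝ} (hC : ∀ᵐ x ∂ν, IsMultiplier (C x) κ)
    (hi : ∀ k, Integrable (fun x => C x k) ν) :
    IsMultiplier (fun k => ∫ x, C x k ∂ν) (κ * ν.real Set.univ) := fun p M hp y hy => by
  have : (scaleCoeff (fun k => ∫ x, C x k ∂ν) p).eval y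
      = ∫ x, (scaleCoeff (C x) p).eval y ∂ν := by
    simp only [eval_scaleCoeff]
    rw [integral_finsetSum _ fun k _ => ((hi k).mul_const _).mul_const _]
    refine Finset.sum_congr rfl fun k _ => ?_
    rw [integral_mul_const, integral_mul_const]
  rw [this, ← Real.norm_eq_abs]
  refine (norm_integral_le_of_norm_le_const (C := κ * M) ?_).trans (le_of_eq (by ring))
  filter_upwards [hC] with x hx using hx p M hp y hy

/-- Write the exponential as the limit of `(1 + c/m)^m`, of norm at most `(1 + κ/m)^m`. -/
theorem exp (hc : IsMultiplier c κ) :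
    IsMultiplier (fun k => Real.exp (c k)) (Real.exp κ) := by
  refine of_tendsto (l := atTop) (C := fun (m : ℕ) k => (1 + c k / m) ^ m)
    (K := fun m : ℕ => (1 + κ / m) ^ m) (Eventually.of_forall fun m => ?_)
    (fun k => Real.tendsto_one_add_div_pow_exp _) (Real.tendsto_one_add_div_pow_exp _)
  have h := hc.const_mul (m : ℝ)⁻¹
  rw [abs_of_nonneg (by positivity)] at h
  simpa only [div_eq_inv_mul] using (one.add h).pow m

theorem expIntegral (hc : IsMultiplier c κ) (hκ : 0 ≤ κ) :
    IsMultiplier (fun k => ∫ h in (0 : ℝ)..1, Real.exp (h * c k)) (Real.exp κ) := by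
  have := integral (ν := volume.restrict (Set.Ioc (0 : ℝ) 1))
    (C := fun h k => Real.exp (h * c k)) (κ := Real.exp κ) ?_ ?_
  · simpa [intervalIntegral.integral_of_le] using this
  · filter_upwards [ae_restrict_mem measurableSet_Ioc] with h hh
    have h1 := (hc.const_mul h).exp
    refine h1.mono (Real.exp_le_exp.2 ?_)
    rw [abs_of_pos hh.1]
    exact mul_le_of_le_one_left hκ hh.2
  · intro k
    exact (Continuous.integrableOn_Ioc (by fun_prop))

end IsMultiplier

theorem exp_sub_one_eq_mul_integral (x : ℝ) :
    Real.exp x - 1 = x * ∫ h in (0 : ℝ)..1, Real.exp (h * x) := by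
  rw [← intervalIntegral.integral_const_mul]
  rw [intervalIntegral.integral_eq_sub_of_hasDerivAt (f := fun h => Real.exp (h * x))]
  · simp
  · intro h _
    simpa [mul_comm] using ((hasDerivAt_id h).mul_const x).exp
  · exact Continuous.intervalIntegrable (by fun_prop) _ _

namespace IsMultiplier

variable {c : ℕ → ℝ} {κ : ℝ}

/-- The factor `c` is split off, so the norm is small when `κ` is; subtracting `one` from `exp`
would only give `e^κ + 1`. -/
theorem exp_sub_one (hc : IsMultiplier c κ) (hκ : 0 ≤ κ) :
    IsMultiplier (fun k => Real.exp (c k) - 1) (κ * Real.exp κ) := by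
  simp only [exp_sub_one_eq_mul_integral]
  exact hc.mul (hc.expIntegral hκ)

/-- These are Laplace transforms of Poisson sums. The constant `e^{-ν(X)}` exactly cancels the norm
`e^{ν(X)}` of `exp ∫ w^k dν`, whence the bound `1` whatever the mass of `ν`. -/
theorem exp_neg_integral_of_finite {X : Type*} [MeasurableSpace X] {ν : Measure X}
    [IsFiniteMeasure ν] {w : X → ℝ} (hw : Measurable w) (h01 : ∀ᵐ x ∂ν, w x ∈ Set.Icc (0 : ℝ) 1) :
    IsMultiplier (fun k => Real.exp (-∫ x, (1 - w x ^ k) ∂ν)) 1 := by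
  have hi : ∀ k, Integrable (fun x => w x ^ k) ν := fun k => by
    refine Integrable.of_bound (hw.pow_const k).aestronglyMeasurable 1 ?_
    filter_upwards [h01] with x hx
    rw [norm_pow, Real.norm_of_nonneg hx.1]
    exact pow_le_one₀ hx.1 hx.2
  have h := (integral (ν := ν) (C := fun x k => w x ^ k)
    (by filter_upwards [h01] with x hx using geom hx) hi).exp.const_mul
      (Real.exp (-(ν.real Set.univ)))
  rw [one_mul, abs_of_pos (Real.exp_pos _), ← Real.exp_add, neg_add_cancel, Real.exp_zero] at h
  convert h using 2 with k
  rw [← Real.exp_add, integral_sub (integrable_const _) (hi k)]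
  simp only [integral_const, smul_eq_mul, mul_one]
  congr 1
  ring

theorem exp_neg_integral {X : Type*} [MeasurableSpace X] {ν : Measure X}
    [SigmaFinite ν] {w : X → ℝ} (hw : Measurable w) (h01 : ∀ᵐ x ∂ν, w x ∈ Set.Icc (0 : ℝ) 1)
    (hi : ∀ k : ℕ, Integrable (fun x => 1 - w x ^ k) ν) :
    IsMultiplier (fun k => Real.exp (-∫ x, (1 - w x ^ k) ∂ν)) 1 := by
  refine of_tendsto (l := atTop)
    (C := fun j k => Real.exp (-∫ x in spanningSets ν j, (1 - w x ^ k) ∂ν))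
    (K := fun _ => 1) (Eventually.of_forall fun j => ?_) (fun k => ?_) tendsto_const_nhds
  · have : IsFiniteMeasure (ν.restrict (spanningSets ν j)) :=
      ⟨by simpa using measure_spanningSets_lt_top ν j⟩
    exact exp_neg_integral_of_finite hw (ae_restrict_of_ae h01)
  · have := tendsto_setIntegral_of_monotone (μ := ν) (f := fun x => 1 - w x ^ k)
      (measurableSet_spanningSets ν) (monotone_spanningSets ν) (hi k).integrableOn
    rw [iUnion_spanningSets, Measure.restrict_univ] at this
    exact (Real.continuous_exp.tendsto _).comp this.neg

theorem integral_exp_neg {X : Type*} [MeasurableSpace X] (ν : Measure X)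
    [IsProbabilityMeasure ν] {f : X → ℝ} (hf : Measurable f) (h0 : ∀ x, 0 ≤ f x) :
    IsMultiplier (fun k => ∫ x, Real.exp (-(k * f x)) ∂ν) 1 := by
  have h := integral (ν := ν) (C := fun x (k : ℕ) => Real.exp (-(k * f x))) (κ := 1)
    (Eventually.of_forall fun x => ?_) fun k => ?_
  · simpa using h
  · convert geom (w := Real.exp (-f x)) ⟨(Real.exp_pos _).le, Real.exp_le_one_iff.2 (by
      linarith [h0 x])⟩ using 2 with k
    rw [← Real.exp_nat_mul, mul_neg]
  · refine Integrable.of_bound (by fun_prop) 1 (Eventually.of_forall fun x => ?_)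
    rw [Real.norm_of_nonneg (Real.exp_pos _).le, Real.exp_le_one_iff]
    have := h0 x
    have : 0 ≤ (k : ℝ) * f x := by positivity
    linarith

end IsMultiplier

/-! ### From multipliers to total variation. -/

theorem integrable_of_abs_le_one {X : Type*} [MeasurableSpace X] {μ : Measure X}
    [IsFiniteMeasure μ] {f : X → ℝ} (hf : Measurable f) (h : ∀ x, |f x| ≤ 1) : Integrable f μ :=
  Integrable.of_bound hf.aestronglyMeasurable 1 (Eventually.of_forall h)

theorem exp_neg_mem_Icc (z : ℝ≥0) : Real.exp (-(z : ℝ)) ∈ Set.Icc (0 : ℝ) 1 :=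
  ⟨(Real.exp_pos _).le, Real.exp_le_one_iff.2 (neg_nonpos.2 z.2)⟩

/-- Weierstrass approximation within `ε` on `[0,1]` costs `ε` for each measure and raises the sup
norm to at most `1 + ε`; then `ε → 0`. -/
theorem abs_integral_sub_le_of_continuous {μ ν : Measure ℝ≥0} [IsProbabilityMeasure μ]
    [IsProbabilityMeasure ν] {κ : ℝ}
    (hκ : ∀ (p : Polynomial ℝ) (M : ℝ), (∀ y ∈ Set.Icc (0 : ℝ) 1, |p.eval y| ≤ M) →
      |∫ z : ℝ≥0, p.eval (Real.exp (-(z : ℝ))) ∂μ - ∫ z : ℝ≥0, p.eval (Real.exp (-(z : ℝ))) ∂ν|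
        ≤ κ * M)
    {f : ℝ → ℝ} (hf : Continuous f) (h1 : ∀ y, |f y| ≤ 1) :
    |∫ z : ℝ≥0, f (Real.exp (-(z : ℝ))) ∂μ - ∫ z : ℝ≥0, f (Real.exp (-(z : ℝ))) ∂ν| ≤ κ := by
  have key : ∀ ε : ℝ, 0 < ε →
      |∫ z : ℝ≥0, f (Real.exp (-(z : ℝ))) ∂μ - ∫ z : ℝ≥0, f (Real.exp (-(z : ℝ))) ∂ν|
        ≤ 2 * ε + κ * (1 + ε) := by
    intro ε hε
    obtain ⟨p, hp⟩ := exists_polynomial_near_of_continuousOn 0 1 f hf.continuousOn ε hε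
    have hpb : ∀ y ∈ Set.Icc (0 : ℝ) 1, |p.eval y| ≤ 1 + ε := fun y hy => by
      have := abs_add_le (f y) (p.eval y - f y)
      rw [add_sub_cancel] at this
      linarith [h1 y, hp y hy]
    have hc : Continuous fun z : ℝ≥0 => Real.exp (-(z : ℝ)) := by fun_prop
    have hd : ∀ (m : Measure ℝ≥0) [IsProbabilityMeasure m],
        |∫ z : ℝ≥0, f (Real.exp (-(z : ℝ))) ∂m - ∫ z : ℝ≥0, p.eval (Real.exp (-(z : ℝ))) ∂m|
          ≤ ε := by
      intro m _
      rw [← integral_sub]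
      · rw [← Real.norm_eq_abs]
        refine (norm_integral_le_of_norm_le_const (C := ε) (Eventually.of_forall fun z => ?_)).trans
          (by rw [probReal_univ, mul_one])
        rw [Real.norm_eq_abs, abs_sub_comm]
        exact (hp _ (exp_neg_mem_Icc z)).le
      · exact integrable_of_abs_le_one (hf.comp hc).measurable fun z => h1 _
      · exact Integrable.of_bound (p.continuous.comp hc).aestronglyMeasurable (1 + ε)
          (Eventually.of_forall fun z => hpb _ (exp_neg_mem_Icc z))
    have e1 := abs_le.1 (hd μ)
    have e2 := abs_le.1 (hd ν)
    have e3 := abs_le.1 (hκ p (1 + ε) hpb)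
    rw [abs_le]
    constructor <;> linarith
  have ht : Tendsto (fun ε : ℝ => 2 * ε + κ * (1 + ε)) (𝓝[>] 0) (𝓝 κ) := by
    have : Tendsto (fun ε : ℝ => 2 * ε + κ * (1 + ε)) (𝓝 0) (𝓝 (2 * 0 + κ * (1 + 0))) :=
      Continuous.tendsto (by fun_prop) 0
    simp only [mul_zero, add_zero, mul_one, zero_add] at this
    exact this.mono_left nhdsWithin_le_nhds
  exact ge_of_tendsto ht (by filter_upwards [self_mem_nhdsWithin] with ε hε using key ε hε)

theorem abs_clip_le (a : ℝ) : |max (-1) (min a 1)| ≤ 1 :=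
  abs_le.2 ⟨le_max_left _ _, max_le (by norm_num) (min_le_right _ _)⟩

theorem abs_sub_clip_le {r : ℝ} (hr : |r| ≤ 1) (a : ℝ) :
    |r - max (-1) (min a 1)| ≤ |r - a| := by
  obtain ⟨h1, h2⟩ := abs_le.1 hr
  rcases le_total a 1 with h | h
  · rw [min_eq_left h]
    rcases le_total (-1) a with h' | h'
    · rw [max_eq_right h']
    · rw [max_eq_left h', abs_of_nonneg (by linarith), abs_of_nonneg (by linarith)]
      linarith
  · rw [min_eq_right h, max_eq_right (by norm_num), abs_of_nonpos (by linarith),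
      abs_of_nonpos (by linarith)]
    linarith

/-- A bound on the differences of the integrals of polynomials in `e^{-z}` extends to all
bounded measurable functions. -/
theorem abs_integral_sub_le {μ ν : Measure ℝ≥0} [IsProbabilityMeasure μ]
    [IsProbabilityMeasure ν] {κ : ℝ}
    (hκ : ∀ (p : Polynomial ℝ) (M : ℝ), (∀ y ∈ Set.Icc (0 : ℝ) 1, |p.eval y| ≤ M) →
      |∫ z : ℝ≥0, p.eval (Real.exp (-(z : ℝ))) ∂μ - ∫ z : ℝ≥0, p.eval (Real.exp (-(z : ℝ))) ∂ν|
        ≤ κ * M)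
    {h : ℝ≥0 → ℝ} (hm : Measurable h) (h1 : ∀ z, |h z| ≤ 1) :
    |∫ z, h z ∂μ - ∫ z, h z ∂ν| ≤ κ := by
  refine le_of_forall_pos_le_add fun ε hε => ?_
  let e : ℝ≥0 → ℝ := fun z => Real.exp (-(z : ℝ))
  have he : Measurable e := by fun_prop
  -- `h` is transported to the variable `y = e^{-z}`, where polynomials live.
  let h' : ℝ → ℝ := fun y => h (Real.toNNReal (-Real.log y))
  have hh' : Measurable h' := by fun_prop
  have hcomp : ∀ z, h' (e z) = h z := fun z => by simp [h', e]
  -- Approximating in `L¹` of the sum gives one continuous function that serves both measures.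
  have hint : Integrable h' ((μ + ν).map e) := integrable_of_abs_le_one hh' fun y => h1 _
  obtain ⟨g, hg, -⟩ := hint.exists_boundedContinuous_integral_sub_le hε
  -- Clipping to `[-1,1]` restores the sup bound and does not increase the distance to `h`.
  let f : ℝ → ℝ := fun y => max (-1) (min (g y) 1)
  have hf : Continuous f := by fun_prop
  have hf1 : ∀ y, |f y| ≤ 1 := fun y => abs_clip_le _
  have hfm : Measurable fun z => f (e z) := hf.measurable.comp he
  have hdm : Measurable fun z => |h z - f (e z)| := by fun_prop
  have hdi : ∀ (m : Measure ℝ≥0) [IsFiniteMeasure m],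
      Integrable (fun z => |h z - f (e z)|) m := fun m _ =>
    ((integrable_of_abs_le_one hm h1).sub (integrable_of_abs_le_one hfm fun z => hf1 _)).abs
  have hsum : (∫ z, |h z - f (e z)| ∂μ) + ∫ z, |h z - f (e z)| ∂ν ≤ ε := by
    rw [← integral_add_measure (hdi μ) (hdi ν)]
    have hmeas : AEStronglyMeasurable (fun y => ‖h' y - g y‖) ((μ + ν).map e) :=
      (hh'.sub g.continuous.measurable).norm.aestronglyMeasurable
    rw [integral_map he.aemeasurable hmeas] at hg
    refine le_trans (integral_mono (hdi _) ?_ fun z => ?_) hg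
    · refine Integrable.norm (f := fun z => h' (e z) - g (e z)) (Integrable.sub ?_ ?_)
      · simpa only [hcomp] using integrable_of_abs_le_one hm h1
      · exact Integrable.of_bound (g.continuous.measurable.comp he).aestronglyMeasurable ‖g‖
          (Eventually.of_forall fun z => g.norm_coe_le_norm _)
    · simp only [hcomp]
      exact abs_sub_clip_le (h1 z) _
  have hd : ∀ (m : Measure ℝ≥0) [IsProbabilityMeasure m],
      |∫ z, h z ∂m - ∫ z, f (e z) ∂m| ≤ ∫ z, |h z - f (e z)| ∂m := by
    intro m _
    rw [← integral_sub (integrable_of_abs_le_one hm h1)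
      (integrable_of_abs_le_one hfm fun z => hf1 _)]
    exact abs_integral_le_integral_abs
  have e1 := abs_le.1 (hd μ)
  have e2 := abs_le.1 (hd ν)
  have e3 := abs_le.1 (abs_integral_sub_le_of_continuous hκ hf hf1)
  rw [abs_le]
  constructor <;> linarith

/-- If the difference of the Laplace transforms at the integers is a multiplier of norm `κ`, then
the integrals of measurable functions bounded by `1` differ by at most `κ`. -/
theorem IsMultiplier.abs_integral_sub_le {μ ν : Measure ℝ≥0} [IsProbabilityMeasure μ]
    [IsProbabilityMeasure ν] {κ : ℝ}
    (hκ : IsMultiplier (fun k => (∫ z : ℝ≥0, Real.exp (-((k : ℝ) * (z : ℝ))) ∂μ)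
      - ∫ z : ℝ≥0, Real.exp (-((k : ℝ) * (z : ℝ))) ∂ν) κ)
    {h : ℝ≥0 → ℝ} (hm : Measurable h) (h1 : ∀ z, |h z| ≤ 1) :
    |∫ z, h z ∂μ - ∫ z, h z ∂ν| ≤ κ := by
  refine CBI.abs_integral_sub_le (fun p M hp => ?_) hm h1
  have hi : ∀ (m : Measure ℝ≥0) [IsProbabilityMeasure m],
      ∫ z : ℝ≥0, p.eval (Real.exp (-(z : ℝ))) ∂m
        = ∑ k ∈ Finset.range (p.natDegree + 1),
          p.coeff k * ∫ z : ℝ≥0, Real.exp (-((k : ℝ) * (z : ℝ))) ∂m := by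
    intro m _
    simp only [Polynomial.eval_eq_sum_range, ← Real.exp_nat_mul, mul_neg]
    have hint : ∀ k ∈ Finset.range (p.natDegree + 1),
        Integrable (fun z : ℝ≥0 => p.coeff k * Real.exp (-((k : ℝ) * (z : ℝ)))) m := by
      intro k _
      refine (integrable_of_abs_le_one (by fun_prop) fun z => ?_).const_mul _
      rw [abs_of_pos (Real.exp_pos _), Real.exp_le_one_iff, neg_nonpos]
      positivity
    rw [integral_finsetSum _ hint]
    simp only [integral_const_mul]
  -- At `y = 1` the transformed polynomial is the difference of the two integrals of `p(e^{-z})`.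
  have := hκ p M hp 1 ⟨zero_le_one, le_rfl⟩
  rw [eval_scaleCoeff] at this
  rw [hi μ, hi ν, ← Finset.sum_sub_distrib]
  refine le_of_eq_of_le (congrArg _ (Finset.sum_congr rfl fun k _ => ?_)) this
  rw [one_pow]; ring

/-! ### Cylinder sets and finite-dimensional laws. -/

theorem sigmaOf_eq_generateFrom {Ω : Type*} (Y : ℝ → Ω → ℝ≥0) (I : Set ℝ) :
    sigmaOf Y I = MeasurableSpace.generateFrom (piiUnionInter
      (fun s => {A | MeasurableSet[MeasurableSpace.comap (Y s) inferInstance] A}) I) :=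
  (generateFrom_piiUnionInter_measurableSet _ _).symm

theorem isPiSystem_cylinder {Ω : Type*} (Y : ℝ → Ω → ℝ≥0) (I : Set ℝ) :
    IsPiSystem (piiUnionInter
      (fun s => {A | MeasurableSet[MeasurableSpace.comap (Y s) inferInstance] A}) I) :=
  isPiSystem_piiUnionInter _ (fun s => @MeasurableSpace.isPiSystem_measurableSet _
    (MeasurableSpace.comap (Y s) inferInstance)) _

theorem exists_of_mem_piiUnionInter {Ω : Type*} {Y : ℝ → Ω → ℝ≥0} {I : Set ℝ} {A : Set Ω}
    (hA : A ∈ piiUnionInter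
      (fun s => {A | MeasurableSet[MeasurableSpace.comap (Y s) inferInstance] A}) I) :
    ∃ (F : Finset ℝ) (C : ℝ → Set ℝ≥0), (∀ u ∈ F, u ∈ I) ∧ (∀ u, MeasurableSet (C u)) ∧
      A = ⋂ u ∈ F, Y u ⁻¹' C u := by
  obtain ⟨F, hF, f, hf, rfl⟩ := hA
  have : ∀ u, ∃ C : Set ℝ≥0, MeasurableSet C ∧ (u ∈ F → Y u ⁻¹' C = f u) := fun u => by
    by_cases hu : u ∈ F
    · obtain ⟨C, hC, h⟩ := hf u hu
      exact ⟨C, hC, fun _ => h⟩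
    · exact ⟨∅, .empty, fun h => absurd h hu⟩
  choose C hC h using this
  exact ⟨F, C, fun u hu => hF hu, hC, Set.iInter₂_congr fun u hu => (h u hu).symm⟩

theorem measurableSet_sigmaOf {Ω : Type*} {Y : ℝ → Ω → ℝ≥0} {I : Set ℝ} {u : ℝ} (hu : u ∈ I)
    {C : Set ℝ≥0} (hC : MeasurableSet C) : MeasurableSet[sigmaOf Y I] (Y u ⁻¹' C) :=
  le_iSup₂_of_le (f := fun s (_ : s ∈ I) => MeasurableSpace.comap (Y s) inferInstance) u hu le_rfl
    _ ⟨C, hC, rfl⟩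

theorem sigmaOf_mono {Ω : Type*} {Y : ℝ → Ω → ℝ≥0} {I J : Set ℝ} (h : I ⊆ J) :
    sigmaOf Y I ≤ sigmaOf Y J :=
  biSup_mono h

theorem sigmaOf_le {Ω : Type*} [MeasurableSpace Ω] {Y : ℝ → Ω → ℝ≥0}
    (hY : ∀ t, Measurable (Y t)) (I : Set ℝ) : sigmaOf Y I ≤ ‹MeasurableSpace Ω› :=
  iSup₂_le fun s _ => (hY s).comap_le

theorem strictMono_snoc {m : ℕ} {τ : Fin (m + 1) → ℝ} (hτ : StrictMono τ) {t : ℝ}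
    (ht : τ (Fin.last m) < t) : StrictMono (Fin.snoc τ t : Fin (m + 2) → ℝ) := by
  intro i j hij
  induction j using Fin.lastCases with
  | last =>
    induction i using Fin.lastCases with
    | last => exact absurd hij (lt_irrefl _)
    | cast i =>
      simp only [Fin.snoc_castSucc, Fin.snoc_last]
      exact (hτ.monotone (Fin.le_last i)).trans_lt ht
  | cast j =>
    induction i using Fin.lastCases with
    | last => exact absurd hij (not_lt.2 (Fin.le_last _))
    | cast i =>
      simp only [Fin.snoc_castSucc]
      exact hτ (by simpa using hij)

theorem HasPathLaw.map_apply_eq {Ω : Type*} [MeasurableSpace Ω] {μ : Measure Ω}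
    {P : ℝ≥0 → Kernel ℝ≥0 ℝ≥0} {η : Measure ℝ≥0} {Y : ℝ → Ω → ℝ≥0}
    (hY : HasPathLaw μ P η Y) (t : ℝ) : μ.map (Y t) = η := by
  have h := hY.map_eq 0 (fun _ => t) (fun i j hij => absurd hij (by omega))
  have h2 := congrArg (Measure.map fun x : Fin 1 → ℝ≥0 => x 0) h
  have hm := hY.measurable
  rw [pathLaw, Measure.map_map (by fun_prop) (by fun_prop),
    Measure.map_map (by fun_prop) (by fun_prop)] at h2
  simpa [Function.comp_def] using h2

/-! ### The Markov property for the whole past and the whole future. -/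

section Markov

variable {Ω : Type*} [MeasurableSpace Ω] {μ : Measure Ω} [IsProbabilityMeasure μ]
  {P : ℝ≥0 → Kernel ℝ≥0 ℝ≥0} {η : Measure ℝ≥0} {Y : ℝ → Ω → ℝ≥0}

theorem HasPathLaw.measure_inter_preimage (hY : HasPathLaw μ P η Y)
    (hP : ∀ t, IsMarkovKernel (P t)) {m : ℕ} {τ : Fin (m + 1) → ℝ} (hτ : StrictMono τ) {t : ℝ}
    (ht : τ (Fin.last m) < t) {A : Set (Fin (m + 1) → ℝ≥0)} (hA : MeasurableSet A)
    {D : Set ℝ≥0} (hD : MeasurableSet D) :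
    μ ((fun ω i => Y (τ i) ω) ⁻¹' A ∩ Y t ⁻¹' D) =
      ∫⁻ ω in (fun ω i => Y (τ i) ω) ⁻¹' A,
        P (Real.toNNReal (t - τ (Fin.last m))) (Y (τ (Fin.last m)) ω) D ∂μ := by
  have hm := hY.measurable
  have h := hY.map_eq (m + 1) (Fin.snoc τ t) (strictMono_snoc hτ ht)
  rw [pathLaw] at h
  simp only [Fin.snoc_castSucc, Fin.snoc_last] at h
  rw [← hY.map_eq m τ hτ] at h
  have hX : Measurable fun ω (i : Fin (m + 1)) => Y (τ i) ω := by fun_prop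
  have := Measure.isProbabilityMeasure_map (μ := μ) hX.aemeasurable
  have hinit : Measurable fun x : Fin (m + 2) → ℝ≥0 => fun i : Fin (m + 1) => x i.castSucc := by
    fun_prop
  set S : Set (Fin (m + 2) → ℝ≥0) := {x | (fun i : Fin (m + 1) => x i.castSucc) ∈ A ∧
    x (Fin.last (m + 1)) ∈ D} with hSdef
  have hS : MeasurableSet S := (hinit hA).inter (measurable_pi_apply (Fin.last (m + 1)) hD)
  have h2 := DFunLike.congr_fun h S
  have hsnoc : Measurable fun p : (Fin (m + 1) → ℝ≥0) × ℝ≥0 =>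
      (Fin.snoc p.1 p.2 : Fin (m + 2) → ℝ≥0) := by
    refine measurable_pi_lambda _ fun i => ?_
    induction i using Fin.lastCases with
    | last => simpa only [Fin.snoc_last] using measurable_snd
    | cast i => simp only [Fin.snoc_castSucc]; fun_prop
  have hfull : Measurable fun ω (i : Fin (m + 2)) => Y ((Fin.snoc τ t : Fin (m + 2) → ℝ) i) ω := by
    fun_prop
  rw [Measure.map_apply hfull hS, Measure.map_apply hsnoc hS] at h2
  have e1 : (fun ω (i : Fin (m + 2)) => Y ((Fin.snoc τ t : Fin (m + 2) → ℝ) i) ω) ⁻¹' S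
      = (fun ω i => Y (τ i) ω) ⁻¹' A ∩ Y t ⁻¹' D := by
    ext ω
    simp [hSdef]
  have e2 : (fun p : (Fin (m + 1) → ℝ≥0) × ℝ≥0 =>
      (Fin.snoc p.1 p.2 : Fin (m + 2) → ℝ≥0)) ⁻¹' S = A ×ˢ D := by
    ext p
    simp [hSdef]
  have hPt := hP (Real.toNNReal (t - τ (Fin.last m)))
  rw [e1, e2, Measure.compProd_apply_prod hA hD] at h2
  rw [h2, setLIntegral_map hA (Kernel.measurable_coe _ hD) hX]
  rfl

/-- For fixed `D`, both sides are finite measures in `A`. They agree on the π-system of cylinders,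
where the identity is the last step of the recursion for `pathLaw`. -/
theorem HasPathLaw.markov (hY : HasPathLaw μ P η Y) (hP : ∀ t, IsMarkovKernel (P t))
    {s t : ℝ} (hst : s < t) {A : Set Ω} (hA : MeasurableSet[sigmaOf Y (Set.Iic s)] A)
    {D : Set ℝ≥0} (hD : MeasurableSet D) :
    μ (A ∩ Y t ⁻¹' D) = ∫⁻ ω in A, P (Real.toNNReal (t - s)) (Y s ω) D ∂μ := by
  have hm := hY.measurable
  have hAm : MeasurableSet A := sigmaOf_le hm _ _ hA
  have basic : ∀ B ∈ piiUnionInter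
      (fun s => {A | MeasurableSet[MeasurableSpace.comap (Y s) inferInstance] A}) (Set.Iic s),
      (μ.restrict (Y t ⁻¹' D)) B
        = (μ.withDensity fun ω => P (Real.toNNReal (t - s)) (Y s ω) D) B := by
    intro B hB
    have hBm : MeasurableSet B := by
      refine sigmaOf_le hm (Set.Iic s) _ ?_
      rw [sigmaOf_eq_generateFrom]
      exact MeasurableSpace.measurableSet_generateFrom hB
    rw [Measure.restrict_apply hBm, withDensity_apply _ hBm]
    obtain ⟨F, C, hF, hC, rfl⟩ := exists_of_mem_piiUnionInter hB
    classical
    -- Adding `s` to the times imposes no constraint but makes `s` the last of them, so that the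
    -- kernel starts from `Y_s`.
    obtain ⟨m, hmc⟩ : ∃ m, (insert s F).card = m + 1 :=
      Nat.exists_eq_succ_of_ne_zero (Finset.card_ne_zero_of_mem (Finset.mem_insert_self s F))
    let τ := (insert s F).orderEmbOfFin hmc
    have hlast : τ (Fin.last m) = s := by
      have hmem := Finset.orderEmbOfFin_mem (insert s F) hmc (Fin.last m)
      obtain ⟨i, hi⟩ : s ∈ Set.range τ := by
        rw [Finset.range_orderEmbOfFin]; simp
      refine le_antisymm ?_ ?_
      · rcases Finset.mem_insert.1 hmem with h | h
        · exact h.le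
        · exact hF _ h
      · rw [← hi]; exact τ.monotone (Fin.le_last i)
    have hpre : (fun ω i => Y (τ i) ω) ⁻¹' {x | ∀ i, τ i ∈ F → x i ∈ C (τ i)}
        = ⋂ u ∈ F, Y u ⁻¹' C u := by
      ext ω
      simp only [Set.mem_preimage, Set.mem_ofPred_eq, Set.mem_iInter]
      refine ⟨fun h u hu => ?_, fun h i hi => h _ hi⟩
      obtain ⟨i, rfl⟩ : u ∈ Set.range τ := by
        rw [Finset.range_orderEmbOfFin]; simp [hu]
      exact h i hu
    have hms : MeasurableSet {x : Fin (m + 1) → ℝ≥0 | ∀ i, τ i ∈ F → x i ∈ C (τ i)} := by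
      have : {x : Fin (m + 1) → ℝ≥0 | ∀ i, τ i ∈ F → x i ∈ C (τ i)}
          = ⋂ i, ⋂ (_ : τ i ∈ F), (fun x : Fin (m + 1) → ℝ≥0 => x i) ⁻¹' C (τ i) := by
        ext x; simp
      rw [this]
      exact .iInter fun i => .iInter fun _ => measurable_pi_apply i (hC _)
    have h := hY.measure_inter_preimage hP τ.strictMono (hlast.symm ▸ hst) hms hD
    rwa [hpre, hlast] at h
  have key := ext_on_measurableSpace_of_generate_finite ‹MeasurableSpace Ω› (s := A)
    (μ := μ.restrict (Y t ⁻¹' D))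
    (ν := μ.withDensity fun ω => P (Real.toNNReal (t - s)) (Y s ω) D) _ basic
    (sigmaOf_le hm _) (sigmaOf_eq_generateFrom Y (Set.Iic s)) (isPiSystem_cylinder Y _)
    (basic Set.univ ⟨∅, by simp, fun _ => ∅, by simp, by simp⟩) hA
  rwa [Measure.restrict_apply hAm, withDensity_apply _ hAm] at key

theorem HasPathLaw.markov_lintegral (hY : HasPathLaw μ P η Y) (hP : ∀ t, IsMarkovKernel (P t))
    {s t : ℝ} (hst : s < t) {A : Set Ω} (hA : MeasurableSet[sigmaOf Y (Set.Iic s)] A)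
    {f : ℝ≥0 → ℝ≥0∞} (hf : Measurable f) :
    ∫⁻ ω in A, f (Y t ω) ∂μ
      = ∫⁻ ω in A, ∫⁻ y, f y ∂(P (Real.toNNReal (t - s)) (Y s ω)) ∂μ := by
  have hm := hY.measurable
  have hAm : MeasurableSet A := sigmaOf_le hm _ _ hA
  have h : (μ.restrict A).map (Y t)
      = ((μ.restrict A).map (Y s)).bind (P (Real.toNNReal (t - s))) := by
    ext D hD
    rw [Measure.map_apply (hm t) hD, Measure.bind_apply hD (Kernel.aemeasurable _),
      lintegral_map (Kernel.measurable_coe _ hD) (hm s),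
      Measure.restrict_apply (hm t hD), Set.inter_comm]
    exact hY.markov hP hst hA hD
  rw [← lintegral_map hf (hm t), h, Measure.lintegral_bind (Kernel.aemeasurable _) hf.aemeasurable,
    lintegral_map hf.lintegral_kernel (hm s)]

/-- `B` is conditionally independent of `σ{Y_u : u ≤ s}` given `Y_s`: its conditional probability
is a function of `Y_s`. -/
def DependsOnPresent (μ : Measure Ω) (Y : ℝ → Ω → ℝ≥0) (s : ℝ) (B : Set Ω) : Prop :=
  ∃ h : ℝ≥0 → ℝ≥0∞, Measurable h ∧ (∀ x, h x ≤ 1) ∧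
    ∀ A, MeasurableSet[sigmaOf Y (Set.Iic s)] A → μ (A ∩ B) = ∫⁻ ω in A, h (Y s ω) ∂μ

/-- Induction that adds the smallest time `a`: the later times are handled with present `a`, and one
transition from `s` to `a` integrates the result. -/
theorem HasPathLaw.dependsOnPresent_cylinder (hY : HasPathLaw μ P η Y)
    (hP : ∀ t, IsMarkovKernel (P t)) {C : ℝ → Set ℝ≥0} (hC : ∀ u, MeasurableSet (C u))
    (F : Finset ℝ) : ∀ s, (∀ u ∈ F, s < u) → DependsOnPresent μ Y s (⋂ u ∈ F, Y u ⁻¹' C u) := by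
  classical
  induction F using Finset.induction_on_min with
  | empty => exact fun s _ => ⟨fun _ => 1, measurable_const, fun _ => le_rfl, fun A _ => by simp⟩
  | insert a F ha ih =>
    intro s hs
    obtain ⟨h, hh, h1, hA⟩ := ih a ha
    have hsa := hs a (Finset.mem_insert_self a F)
    have hf : Measurable ((C a).indicator h) := hh.indicator (hC a)
    refine ⟨fun x => ∫⁻ y, (C a).indicator h y ∂(P (Real.toNNReal (a - s)) x),
      hf.lintegral_kernel, fun x => ?_, fun A hAs => ?_⟩
    · have := hP (Real.toNNReal (a - s))
      refine (lintegral_mono (g := fun _ => 1) fun y => ?_).trans (by simp)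
      exact (Set.indicator_le_self _ _ y).trans (h1 y)
    · rw [← hY.markov_lintegral hP hsa hAs hf, Finset.set_biInter_insert, ← Set.inter_assoc, hA]
      · rw [← lintegral_indicator, ← lintegral_indicator]
        · congr 1
          ext ω
          by_cases h1 : ω ∈ A <;> by_cases h2 : Y a ω ∈ C a <;> simp [h1, h2]
        · exact sigmaOf_le hY.measurable _ _ hAs
        · exact (sigmaOf_le hY.measurable _ _ hAs).inter (hY.measurable a (hC a))
      · exact MeasurableSet.inter (sigmaOf_mono (Set.Iic_subset_Iic.2 hsa.le) _ hAs)
          (measurableSet_sigmaOf (Set.mem_Iic.2 le_rfl) (hC a))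

/-- The densities add up. Their sum is at most `1` only almost everywhere for the law of `Y_s`, as
seen by testing on sets `{Y_s ∈ C}`; the minimum with `1` repairs the null set. -/
theorem HasPathLaw.dependsOnPresent_iUnion (hY : HasPathLaw μ P η Y) {s : ℝ} {B : ℕ → Set Ω}
    (hd : Pairwise (Function.onFun Disjoint B)) (hB : ∀ i, MeasurableSet (B i))
    (h : ∀ i, DependsOnPresent μ Y s (B i)) : DependsOnPresent μ Y s (⋃ i, B i) := by
  choose g hg h1 hA using h
  have hm := hY.measurable
  have hgm : Measurable fun x => ∑' i, g i x := Measurable.tsum hg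
  have hsum : ∀ A, MeasurableSet[sigmaOf Y (Set.Iic s)] A →
      μ (A ∩ ⋃ i, B i) = ∫⁻ ω in A, ∑' i, g i (Y s ω) ∂μ := by
    intro A hAs
    have hgi : ∀ i, Measurable fun ω => g i (Y s ω) := fun i => (hg i).comp (hm s)
    rw [lintegral_tsum fun i => (hgi i).aemeasurable, Set.inter_iUnion,
      measure_iUnion]
    · exact tsum_congr fun i => hA i A hAs
    · exact fun i j hij => (hd hij).mono Set.inter_subset_right Set.inter_subset_right
    · exact fun i => (sigmaOf_le hm _ _ hAs).inter (hB i)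
  have := Measure.isProbabilityMeasure_map (μ := μ) (hm s).aemeasurable
  have hle : (fun x => ∑' i, g i x) ≤ᵐ[μ.map (Y s)] fun _ => 1 := by
    refine ae_le_of_forall_setLIntegral_le_of_sigmaFinite hgm fun C hC _ => ?_
    rw [setLIntegral_map hC hgm (hm s), ← hsum _ (measurableSet_sigmaOf (Set.mem_Iic.2 le_rfl) hC)]
    simp only [lintegral_one, Measure.restrict_apply_univ]
    rw [Measure.map_apply (hm s) hC]
    exact measure_mono Set.inter_subset_left
  have hle' := ae_of_ae_map (hm s).aemeasurable hle
  refine ⟨fun x => min (∑' i, g i x) 1, hgm.min measurable_const, fun x => min_le_right _ _,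
    fun A hAs => ?_⟩
  rw [hsum A hAs]
  refine lintegral_congr_ae (ae_restrict_of_ae ?_)
  filter_upwards [hle'] with ω hω
  exact (min_eq_left hω).symm

theorem HasPathLaw.dependsOnPresent_compl (hY : HasPathLaw μ P η Y) {s : ℝ} {B : Set Ω}
    (hB : MeasurableSet B) (h : DependsOnPresent μ Y s B) : DependsOnPresent μ Y s Bᶜ := by
  obtain ⟨g, hg, h1, hA⟩ := h
  have hm := hY.measurable
  refine ⟨fun x => 1 - g x, measurable_const.sub hg, fun x => tsub_le_self, fun A hAs => ?_⟩
  have hgs : Measurable fun ω => g (Y s ω) := hg.comp (hm s)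
  change _ = ∫⁻ ω in A, 1 - g (Y s ω) ∂μ
  rw [lintegral_sub hgs _ (Eventually.of_forall fun ω => h1 _), ← hA A hAs]
  · simp only [lintegral_one, Measure.restrict_apply_univ]
    rw [← Set.sdiff_eq, ← Set.sdiff_self_inter,
      measure_sdiff Set.inter_subset_left ((sigmaOf_le hm _ _ hAs).inter hB).nullMeasurableSet
        (measure_ne_top _ _)]
  · rw [← hA A hAs]; exact measure_ne_top _ _

theorem HasPathLaw.dependsOnPresent (hY : HasPathLaw μ P η Y) (hP : ∀ t, IsMarkovKernel (P t))
    {s : ℝ} {B : Set Ω} (hB : MeasurableSet[sigmaOf Y (Set.Ioi s)] B) :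
    DependsOnPresent μ Y s B := by
  have hle := sigmaOf_le hY.measurable (Set.Ioi s)
  refine MeasurableSpace.induction_on_inter (m := sigmaOf Y (Set.Ioi s))
    (C := fun B _ => DependsOnPresent μ Y s B) (sigmaOf_eq_generateFrom Y _)
    (isPiSystem_cylinder Y _) ⟨0, measurable_zero, by simp, by simp⟩ (fun B hB => ?_)
    (fun B hB h => hY.dependsOnPresent_compl (hle _ hB) h)
    (fun B hd hB h => hY.dependsOnPresent_iUnion hd (fun i => hle _ (hB i)) h) B hB
  obtain ⟨F, C, hF, hC, rfl⟩ := exists_of_mem_piiUnionInter hB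
  exact hY.dependsOnPresent_cylinder hP hC F s hF

end Markov

/-! ### Mixing from the merging of transition laws. -/

section Mixing

variable {Ω : Type*} [MeasurableSpace Ω] {μ : Measure Ω} [IsProbabilityMeasure μ]
  {P : ℝ≥0 → Kernel ℝ≥0 ℝ≥0} {η : Measure ℝ≥0} [IsProbabilityMeasure η] {Y : ℝ → Ω → ℝ≥0}

theorem measurable_integral_kernel (κ : Kernel ℝ≥0 ℝ≥0) [IsMarkovKernel κ] {h : ℝ≥0 → ℝ}
    (hm : Measurable h) : Measurable fun x => ∫ y, h y ∂κ x :=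
  (hm.stronglyMeasurable.integral_kernel (κ := κ)).measurable

theorem abs_integral_le_one {X : Type*} [MeasurableSpace X] {ν : Measure X}
    [IsProbabilityMeasure ν] {h : X → ℝ} (h1 : ∀ x, |h x| ≤ 1) : |∫ x, h x ∂ν| ≤ 1 := by
  have := norm_integral_le_of_norm_le_const (μ := ν) (f := h) (C := 1) (Eventually.of_forall h1)
  rwa [probReal_univ, mul_one] at this

theorem integrable_comp_of_abs_le_one {X : Type*} [MeasurableSpace X] (ν : Measure X)
    [IsFiniteMeasure ν] {K : ℝ≥0 → ℝ} (hK : Measurable K) (h1 : ∀ x, |K x| ≤ 1) {f : X → ℝ≥0}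
    (hf : Measurable f) : Integrable (fun x => K (f x)) ν :=
  integrable_of_abs_le_one (hK.comp hf) fun _ => h1 _

/-- The covariance is `∫_A (K(Y_0) - ∫ K dη)`, since `Y_0` has law `η`. Writing the inner integral
as an average over an independent copy gives the double integral. -/
theorem HasPathLaw.abs_real_inter_sub_le (hY : HasPathLaw μ P η Y)
    (hP : ∀ t, IsMarkovKernel (P t)) {t : ℝ} (ht : 0 < t) {A B : Set Ω}
    (hA : MeasurableSet[sigmaOf Y (Set.Iic 0)] A) (hB : MeasurableSet[sigmaOf Y (Set.Ioi t)] B) :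
    ∃ h : ℝ≥0 → ℝ, Measurable h ∧ (∀ x, |h x| ≤ 1) ∧
      |μ.real (A ∩ B) - μ.real A * μ.real B| ≤
        ∫ p, |∫ y, h y ∂P t.toNNReal p.1 - ∫ y, h y ∂P t.toNNReal p.2| ∂(η.prod η) := by
  obtain ⟨h, hh, h1, hB⟩ := hY.dependsOnPresent hP hB
  have hm := hY.measurable
  have hPt := hP t.toNNReal
  have hr1 : ∀ x, |(h x).toReal| ≤ 1 := fun x => by
    rw [abs_of_nonneg ENNReal.toReal_nonneg]
    exact ENNReal.toReal_mono ENNReal.one_ne_top (h1 x)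
  refine ⟨fun x => (h x).toReal, hh.ennreal_toReal, hr1, ?_⟩
  set K : ℝ≥0 → ℝ := fun x => ∫ y, (h y).toReal ∂P t.toNNReal x with hK
  have hKm : Measurable K := measurable_integral_kernel _ hh.ennreal_toReal
  have hK1 : ∀ x, |K x| ≤ 1 := fun x => abs_integral_le_one hr1
  have hKY : ∀ (ν : Measure Ω) [IsFiniteMeasure ν], Integrable (fun ω => K (Y 0 ω)) ν :=
    fun ν _ => integrable_comp_of_abs_le_one ν hKm hK1 (hm 0)
  have hKη : Integrable K η := integrable_of_abs_le_one hKm hK1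
  have hKh : ∀ x, (∫⁻ y, h y ∂P t.toNNReal x).toReal = K x := fun x =>
    (integral_toReal hh.aemeasurable
      (Eventually.of_forall fun y => (h1 y).trans_lt ENNReal.one_lt_top)).symm
  have hreal : ∀ A', MeasurableSet[sigmaOf Y (Set.Iic 0)] A' →
      μ.real (A' ∩ B) = ∫ ω in A', K (Y 0 ω) ∂μ := by
    intro A' hA'
    rw [Measure.real, hB A' (sigmaOf_mono (Set.Iic_subset_Iic.2 ht.le) _ hA'),
      hY.markov_lintegral hP ht hA' hh, sub_zero]
    have hle : ∀ x, ∫⁻ y, h y ∂P t.toNNReal x ≤ 1 := fun x =>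
      (lintegral_mono (g := fun _ => 1) h1).trans (by simp)
    have hHm : Measurable fun ω => ∫⁻ y, h y ∂P t.toNNReal (Y 0 ω) :=
      hh.lintegral_kernel.comp (hm 0)
    rw [← integral_toReal hHm.aemeasurable
      (Eventually.of_forall fun ω => (hle _).trans_lt ENNReal.one_lt_top)]
    simp only [hKh]
  have hAm : MeasurableSet A := sigmaOf_le hm _ _ hA
  have hBr : μ.real B = ∫ x, K x ∂η := by
    rw [← Set.univ_inter B, hreal _ MeasurableSet.univ, setIntegral_univ,
      ← hY.map_apply_eq 0, integral_map (hm 0).aemeasurable hKm.aestronglyMeasurable]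
  set c := ∫ x, K x ∂η with hc
  have hdiff : μ.real (A ∩ B) - μ.real A * μ.real B = ∫ ω in A, (K (Y 0 ω) - c) ∂μ := by
    rw [hreal A hA, hBr, integral_sub (hKY _) (integrable_const _), setIntegral_const,
      smul_eq_mul]
  have hint : Integrable (fun p : ℝ≥0 × ℝ≥0 => |K p.1 - K p.2|) (η.prod η) :=
    ((integrable_comp_of_abs_le_one _ hKm hK1 measurable_fst).sub
      (integrable_comp_of_abs_le_one _ hKm hK1 measurable_snd)).abs
  calc |μ.real (A ∩ B) - μ.real A * μ.real B|
      ≤ ∫ ω in A, |K (Y 0 ω) - c| ∂μ := by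
        rw [hdiff]; exact abs_integral_le_integral_abs
    _ ≤ ∫ ω, |K (Y 0 ω) - c| ∂μ :=
        setIntegral_le_integral ((hKY _).sub (integrable_const _)).abs
          (Eventually.of_forall fun _ => abs_nonneg _)
    _ = ∫ x, |K x - c| ∂η := by
        rw [← hY.map_apply_eq 0, integral_map (hm 0).aemeasurable]
        exact (hKm.sub_const c).abs.aestronglyMeasurable
    _ ≤ ∫ x, ∫ y, |K x - K y| ∂η ∂η := by
        refine integral_mono ((hKη).sub (integrable_const _)).abs
          hint.integral_prod_left fun x => ?_
        have : K x - c = ∫ y, (K x - K y) ∂η := by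
          rw [integral_sub (integrable_const _) (hKη)]
          simp [hc]
        simp only [this]
        exact abs_integral_le_integral_abs
    _ = ∫ p, |K p.1 - K p.2| ∂(η.prod η) := (integral_prod _ hint).symm

/-- If the laws `P_t(x,·)` and `P_t(y,·)` merge in total variation for almost all initial states
`x, y`, then the process is strongly mixing. -/
theorem HasPathLaw.tendsto_mixingCoeff (hY : HasPathLaw μ P η Y)
    (hP : ∀ t, IsMarkovKernel (P t))
    (hlim : ∀ᵐ p ∂(η.prod η), ∀ h : ℝ → ℝ≥0 → ℝ, (∀ t, Measurable (h t)) →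
      (∀ t x, |h t x| ≤ 1) →
      Tendsto (fun t => ∫ y, h t y ∂P t.toNNReal p.1 - ∫ y, h t y ∂P t.toNNReal p.2)
        atTop (𝓝 0)) :
    Tendsto (fun t => mixingCoeff μ Y t) atTop (𝓝 0) := by
  have hne : ∀ t, {r : ℝ | ∃ A B : Set Ω, MeasurableSet[sigmaOf Y (Set.Iic 0)] A ∧
      MeasurableSet[sigmaOf Y (Set.Ioi t)] B ∧
        r = |μ.real (A ∩ B) - μ.real A * μ.real B|}.Nonempty := fun t =>
    ⟨_, ∅, ∅, @MeasurableSet.empty _ (sigmaOf Y _), @MeasurableSet.empty _ (sigmaOf Y _), rfl⟩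
  -- The supremum need not be attained, hence the slack `t⁻¹`. The function `h` varies with `t`,
  -- which is why `hlim` is about families.
  have hchoice : ∀ t : ℝ, ∃ h : ℝ≥0 → ℝ, Measurable h ∧ (∀ x, |h x| ≤ 1) ∧
      (0 < t → mixingCoeff μ Y t ≤
        (∫ p, |∫ y, h y ∂P t.toNNReal p.1 - ∫ y, h y ∂P t.toNNReal p.2| ∂(η.prod η)) + t⁻¹) := by
    intro t
    by_cases ht : 0 < t
    · obtain ⟨r, ⟨A, B, hA, hB, rfl⟩, hr⟩ := exists_lt_of_lt_csSup (hne t)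
        (show mixingCoeff μ Y t - t⁻¹ < mixingCoeff μ Y t from sub_lt_self _ (inv_pos.2 ht))
      obtain ⟨h, hm, h1, hle⟩ := hY.abs_real_inter_sub_le hP ht hA hB
      exact ⟨h, hm, h1, fun _ => by linarith⟩
    · exact ⟨0, measurable_zero, by simp, fun h => absurd h ht⟩
  choose h hm h1 hle using hchoice
  have hdom : Tendsto (fun t : ℝ =>
      ∫ p, |∫ y, h t y ∂P t.toNNReal p.1 - ∫ y, h t y ∂P t.toNNReal p.2| ∂(η.prod η))
      atTop (𝓝 (∫ _, (0 : ℝ) ∂(η.prod η))) := by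
    refine tendsto_integral_filter_of_dominated_convergence (fun _ => 2)
      (Eventually.of_forall fun t => ?_) (Eventually.of_forall fun t => Eventually.of_forall
        fun p => ?_) (integrable_const _) ?_
    · have := hP t.toNNReal
      have hK := measurable_integral_kernel (P t.toNNReal) (hm t)
      exact ((hK.comp measurable_fst).sub (hK.comp measurable_snd)).abs.aestronglyMeasurable
    · have := hP t.toNNReal
      rw [Real.norm_eq_abs, abs_abs]
      have e1 := abs_integral_le_one (ν := P t.toNNReal p.1) (h1 t)
      have e2 := abs_integral_le_one (ν := P t.toNNReal p.2) (h1 t)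
      exact (abs_sub _ _).trans (by linarith)
    · filter_upwards [hlim] with p hp
      simpa using (hp h hm h1).abs
  rw [integral_zero] at hdom
  have hsum := hdom.add tendsto_inv_atTop_zero
  rw [add_zero] at hsum
  refine tendsto_of_tendsto_of_tendsto_of_le_of_le' tendsto_const_nhds hsum
    (Eventually.of_forall fun t => ?_) ?_
  · refine Real.sSup_nonneg ?_
    rintro r ⟨A, B, -, -, rfl⟩
    exact abs_nonneg _
  · filter_upwards [eventually_gt_atTop 0] with t ht using hle t ht

end Mixing

/-! ### Laplace transforms at integers, and the case `c > 0`. -/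

theorem IsTransitionSemigroup.integral_exp {b c a : ℝ} {n : Measure ℝ}
    {P : ℝ≥0 → Kernel ℝ≥0 ℝ≥0} (hP : IsTransitionSemigroup b c a n P) {t : ℝ} (ht : 0 ≤ t)
    (x : ℝ≥0) (k : ℕ) :
    ∫ y : ℝ≥0, Real.exp (-((k : ℝ) * (y : ℝ))) ∂(P t.toNNReal x)
      = Real.exp (-((x : ℝ) * cumulant b c t k))
        * Real.exp (-∫ s in (0 : ℝ)..t, immigration a n (cumulant b c s k)) := by
  have h := hP.laplace t.toNNReal x k
  simp only [NNReal.coe_natCast, Real.coe_toNNReal t ht] at h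
  rw [h, ← Real.exp_add, sub_eq_add_neg]

/-- The immigration factor does not depend on the starting point, so it comes out of the difference.
-/
theorem IsTransitionSemigroup.integral_exp_sub {b c a : ℝ} {n : Measure ℝ}
    {P : ℝ≥0 → Kernel ℝ≥0 ℝ≥0} (hP : IsTransitionSemigroup b c a n P) {t : ℝ} (ht : 0 ≤ t)
    (x : ℝ≥0) (k : ℕ) :
    (∫ y : ℝ≥0, Real.exp (-((k : ℝ) * (y : ℝ))) ∂(P t.toNNReal x))
        - ∫ y : ℝ≥0, Real.exp (-((k : ℝ) * (y : ℝ))) ∂(P t.toNNReal 0)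
      = (Real.exp (-((x : ℝ) * cumulant b c t k)) - 1)
        * Real.exp (-∫ s in (0 : ℝ)..t, immigration a n (cumulant b c s k)) := by
  rw [hP.integral_exp ht, hP.integral_exp ht]
  simp
  ring

namespace IsMultiplier

/-- The sequence is the average of `(w^β)^k` over `w` in `(0,1]`. -/
theorem one_div_one_add_mul {β : ℝ} (hβ : 0 ≤ β) :
    IsMultiplier (fun k => 1 / (1 + k * β)) 1 := by
  have h := integral (ν := volume.restrict (Set.Ioc (0 : ℝ) 1))
    (C := fun w (k : ℕ) => w ^ ((k : ℝ) * β)) (κ := 1) ?_ ?_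
  · simp only [measureReal_restrict_apply_univ, Real.volume_real_Ioc, sub_zero, mul_one,
      zero_le_one, max_eq_left] at h
    convert h using 2 with k
    have hk : 0 ≤ (k : ℝ) * β := by positivity
    rw [← intervalIntegral.integral_of_le zero_le_one, integral_rpow (Or.inl (by linarith)),
      Real.one_rpow, Real.zero_rpow (by linarith), sub_zero, add_comm]
  · filter_upwards [ae_restrict_mem measurableSet_Ioc] with w hw
    convert geom (w := w ^ β) ⟨Real.rpow_nonneg hw.1.le _, Real.rpow_le_one hw.1.le hw.2 hβ⟩
      using 2 with k
    rw [← Real.rpow_natCast, ← Real.rpow_mul hw.1.le, mul_comm]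
  · intro k
    have hk : 0 ≤ (k : ℝ) * β := by positivity
    exact ((Real.continuous_rpow_const hk).integrableOn_Ioc)

end IsMultiplier

theorem mul_exp_neg_le_discount {b t : ℝ} (hb : 0 ≤ b) :
    t * Real.exp (-(b * t)) ≤ discount b t := by
  unfold discount
  split_ifs with h
  · simp [h]
  · rw [le_div_iff₀ (lt_of_le_of_ne hb (Ne.symm h))]
    have h1 := Real.add_one_le_exp (b * t)
    have h2 : Real.exp (b * t) * Real.exp (-(b * t)) = 1 := by
      rw [← Real.exp_add]; simp
    nlinarith [Real.exp_pos (-(b * t))]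

/-- The immigration factor is the Laplace transform of `P_t(0,·)`, of norm at most `1`. The other
factor is small because `v_t(k)` stays bounded in `k`. -/
theorem isMultiplier_of_pos {b c a : ℝ} {n : Measure ℝ} {P : ℝ≥0 → Kernel ℝ≥0 ℝ≥0}
    (hb : 0 ≤ b) (hc : 0 < c) (hP : IsTransitionSemigroup b c a n P) {t : ℝ} (ht : 0 < t)
    (x : ℝ≥0) :
    IsMultiplier (fun k => (∫ y : ℝ≥0, Real.exp (-((k : ℝ) * (y : ℝ))) ∂(P t.toNNReal x))
        - ∫ y : ℝ≥0, Real.exp (-((k : ℝ) * (y : ℝ))) ∂(P t.toNNReal 0))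
      (2 * (x / (c * t)) * Real.exp (2 * (x / (c * t)))) := by
  have := hP.isMarkovKernel t.toNNReal
  have h0 : IsMultiplier (fun k : ℕ =>
      Real.exp (-∫ s in (0 : ℝ)..t, immigration a n (cumulant b c s k))) 1 := by
    convert IsMultiplier.integral_exp_neg (P t.toNNReal 0) measurable_coe_nnreal_real
      (fun x => x.2) using 2 with k
    rw [hP.integral_exp ht.le]
    simp
  have hd : 0 < discount b t :=
    lt_of_lt_of_le (by positivity) (mul_exp_neg_le_discount hb)
  set r := (x : ℝ) * (Real.exp (-(b * t)) / (c * discount b t)) with hr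
  have hr0 : 0 ≤ r := by positivity
  have hrle : r ≤ x / (c * t) := by
    rw [hr, div_eq_mul_inv (x : ℝ)]
    refine mul_le_mul_of_nonneg_left ?_ x.2
    rw [inv_eq_one_div, div_le_div_iff₀ (by positivity) (by positivity)]
    nlinarith [mul_exp_neg_le_discount (t := t) hb]
  have hv : ∀ k : ℕ, -((x : ℝ) * cumulant b c t k)
      = -r * (1 - 1 / (1 + k * (c * discount b t))) := by
    intro k
    have : (1 : ℝ) + k * (c * discount b t) ≠ 0 := by positivity
    have h2 : (1 : ℝ) + c * k * discount b t ≠ 0 := by positivity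
    rw [hr]; unfold cumulant
    field_simp
    ring
  have h1 := ((IsMultiplier.one.sub (IsMultiplier.one_div_one_add_mul
    (β := c * discount b t) (by positivity))).const_mul (-r)).exp_sub_one (by positivity)
  rw [abs_neg, abs_of_nonneg hr0] at h1
  have h2 := h1.mul h0
  simp only [hP.integral_exp_sub ht.le, hv]
  refine h2.mono ?_
  rw [mul_one, show r * (1 + 1) = 2 * r by ring]
  gcongr

/-! ### The case `c = 0`: smoothing by immigration jumps. -/

namespace IsMultiplier

theorem exp_neg_mul {z : ℝ} (hz : 0 ≤ z) : IsMultiplier (fun k => Real.exp (-(k * z))) 1 := by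
  convert geom (w := Real.exp (-z)) ⟨(Real.exp_pos _).le, Real.exp_le_one_iff.2 (by linarith)⟩
    using 2 with k
  rw [← Real.exp_nat_mul, mul_neg]

/-- Integration by parts in `r` absorbs the factor `k`: the derivative of `e^{br}/(ub) · exp(-k
e^{-br}u)` is `k exp(-k e^{-br}u)` plus `(e^{br}/u) exp(-k e^{-br}u)`. The constant collects two
boundary terms and one integral. -/
theorem mul_integral_exp_neg {b ε u s : ℝ} (hb : 0 < b) (hε : 0 < ε) (hu : ε ≤ u) (hs : 0 ≤ s) :
    IsMultiplier (fun k => k * ∫ r in (0 : ℝ)..s, Real.exp (-(k * (Real.exp (-(b * r)) * u))))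
      (Real.exp (b * s) / (ε * b) + 1 / (ε * b) + 1 / ε * (Real.exp (b * s) * s)) := by
  have hu0 : 0 < u := hε.trans_le hu
  have h1 := (exp_neg_mul (z := Real.exp (-(b * s)) * u) (by positivity)).const_mul
    (Real.exp (b * s) / (u * b))
  have h2 := (exp_neg_mul (z := Real.exp (-(b * 0)) * u) (by positivity)).const_mul (1 / (u * b))
  have hcont : ∀ k : ℝ, Continuous fun r : ℝ =>
      Real.exp (b * r) * Real.exp (-(k * (Real.exp (-(b * r)) * u))) := fun k => by fun_prop
  have hcont' : ∀ k : ℝ, Continuous fun r : ℝ =>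
      Real.exp (-(k * (Real.exp (-(b * r)) * u))) := fun k => by fun_prop
  have h3 := (integral (ν := volume.restrict (Set.Ioc (0 : ℝ) s))
    (C := fun r (k : ℕ) => Real.exp (b * r) * Real.exp (-(k * (Real.exp (-(b * r)) * u))))
    (κ := Real.exp (b * s)) (by
      filter_upwards [ae_restrict_mem measurableSet_Ioc] with r hr
      refine ((exp_neg_mul (z := Real.exp (-(b * r)) * u) (by positivity)).const_mul
        (Real.exp (b * r))).mono ?_
      rw [mul_one, abs_of_pos (Real.exp_pos _)]
      exact Real.exp_le_exp.2 (mul_le_mul_of_nonneg_left hr.2 hb.le))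
    fun k => (hcont k).integrableOn_Ioc).const_mul (1 / u)
  have h4 := (h1.sub h2).sub h3
  convert h4.mono ?_ using 2 with k
  · rw [← intervalIntegral.integral_of_le hs, ← intervalIntegral.integral_const_mul,
      ← intervalIntegral.integral_const_mul, eq_sub_iff_add_eq,
      ← intervalIntegral.integral_add]
    · rw [intervalIntegral.integral_eq_sub_of_hasDerivAt (f := fun r =>
        Real.exp (b * r) / (u * b) * Real.exp (-(k * (Real.exp (-(b * r)) * u))))]
      · simp
      · intro r _
        have e1 : HasDerivAt (fun r : ℝ => Real.exp (b * r)) (Real.exp (b * r) * b) r := by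
          simpa using ((hasDerivAt_id r).const_mul b).exp
        have e2 : HasDerivAt (fun r : ℝ => Real.exp (-(b * r))) (Real.exp (-(b * r)) * (-b)) r := by
          simpa using ((hasDerivAt_id r).const_mul b).neg.exp
        have e3 := ((e2.mul_const u).const_mul (k : ℝ)).neg.exp
        refine ((e1.div_const (u * b)).mul e3).congr_deriv ?_
        have e4 : Real.exp (b * r) * Real.exp (-(b * r)) = 1 := by
          rw [← Real.exp_add]; simp
        have e5 : Real.exp (b * r) = (Real.exp (-(b * r)))⁻¹ :=
          eq_inv_of_mul_eq_one_left e4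
        simp only [Pi.neg_apply]
        rw [e5]
        have := (Real.exp_pos (-(b * r))).ne'
        field_simp
        ring
      · exact Continuous.intervalIntegrable (by fun_prop) _ _
    · exact ((hcont' k).const_mul _).intervalIntegrable _ _
    · exact ((hcont k).const_mul _).intervalIntegrable _ _
  · have hv : volume.real (Set.Ioc 0 s) = s := by simp [hs]
    rw [measureReal_restrict_apply_univ, hv, mul_one, mul_one, abs_of_pos (by positivity),
      abs_of_pos (by positivity), abs_of_pos (by positivity)]
    gcongr

/-- Split `e^τ = 1 + τ ∫ e^{hτ} dh`. The `1` (no jump) gives `2e^{-m}`. In the rest, `e^{-kε} - 1`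
supplies a factor `kε` whose `k` is absorbed by `τ`, and `e^{-m}` cancels the norm of the integral.
-/
theorem exp_sub_one_mul_exp {τ : ℕ → ℝ} {C m ε : ℝ} (hε : 0 ≤ ε) (hm : 0 ≤ m)
    (hτ : IsMultiplier τ m) (hkτ : IsMultiplier (fun k => k * τ k) C) :
    IsMultiplier (fun k => (Real.exp (-(k * ε)) - 1) * Real.exp (τ k - m))
      (2 * Real.exp (-m) + ε * C) := by
  have h1 := (exp_neg_mul hε).sub one
  have h2 : IsMultiplier (fun k => ∫ h in (0 : ℝ)..1, Real.exp (h * -(k * ε))) 1 := by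
    have := integral (ν := volume.restrict (Set.Ioc (0 : ℝ) 1))
      (C := fun h (k : ℕ) => Real.exp (h * -(k * ε))) (κ := 1) ?_ ?_
    · simpa [intervalIntegral.integral_of_le] using this
    · filter_upwards [ae_restrict_mem measurableSet_Ioc] with h hh
      convert exp_neg_mul (z := h * ε) (mul_nonneg hh.1.le hε) using 3
      ring
    · exact fun k => Continuous.integrableOn_Ioc (by fun_prop)
  have h3 := hτ.expIntegral hm
  have h4 := (h1.add ((h2.mul (hkτ.mul h3)).const_mul (-ε))).const_mul (Real.exp (-m))
  convert h4 using 1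
  · ext k
    have e1 := exp_sub_one_eq_mul_integral (-(k * ε))
    have e2 := exp_sub_one_eq_mul_integral (τ k)
    rw [sub_eq_add_neg (τ k), Real.exp_add]
    have e3 : Real.exp (τ k) = 1 + τ k * ∫ h in (0 : ℝ)..1, Real.exp (h * τ k) := by
      rw [← e2]; ring
    rw [e3, e1]
    ring
  · rw [abs_neg, abs_of_nonneg hε, abs_of_pos (Real.exp_pos _)]
    have : Real.exp (-m) * Real.exp m = 1 := by rw [← Real.exp_add]; simp
    linear_combination (-(ε * C)) * this

end IsMultiplier

theorem integrable_min_one {n : Measure ℝ}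
    (hn : ∫⁻ u in Set.Ioi (0 : ℝ), ENNReal.ofReal (min 1 u) ∂n < ∞) :
    Integrable (fun u : ℝ => min 1 u) (n.restrict (Set.Ioi 0)) := by
  refine ⟨by fun_prop, ?_⟩
  rw [hasFiniteIntegral_iff_ofReal]
  · exact hn
  · filter_upwards [ae_restrict_mem measurableSet_Ioi] with u hu
    exact le_min zero_le_one (le_of_lt hu)

/-- The density `min 1 u` is positive on `(0,∞)` and yields a finite measure, from which the
restriction of `n` is recovered by the inverse density. -/
theorem sigmaFinite_restrict_Ioi {n : Measure ℝ}
    (hn : ∫⁻ u in Set.Ioi (0 : ℝ), ENNReal.ofReal (min 1 u) ∂n < ∞) :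
    SigmaFinite (n.restrict (Set.Ioi 0)) := by
  have hm : Measurable fun u : ℝ => ENNReal.ofReal (min 1 u) := by fun_prop
  have hf : IsFiniteMeasure ((n.restrict (Set.Ioi 0)).withDensity
      fun u => ENNReal.ofReal (min 1 u)) := isFiniteMeasure_withDensity hn.ne
  have hpos : ∀ᵐ u ∂n.restrict (Set.Ioi 0), ENNReal.ofReal (min 1 u) ≠ 0 := by
    filter_upwards [ae_restrict_mem measurableSet_Ioi] with u hu
    simpa using hu
  rw [← withDensity_inv_same hm hpos (Eventually.of_forall fun u => ENNReal.ofReal_ne_top)]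
  refine SigmaFinite.withDensity_of_ne_top (withDensity_absolutelyContinuous _ _ ?_)
  filter_upwards [hpos] with u hu
  simpa using hu

theorem restrict_Ici_lt_top {n : Measure ℝ}
    (hn : ∫⁻ u in Set.Ioi (0 : ℝ), ENNReal.ofReal (min 1 u) ∂n < ∞) {ε : ℝ} (hε : 0 < ε) :
    n.restrict (Set.Ioi 0) (Set.Ici ε) < ∞ := by
  refine lt_of_le_of_lt (measure_mono fun u hu => ?_) ((integrable_min_one hn).measure_ge_lt_top
    (ε := min 1 ε) (lt_min one_pos hε))
  exact min_le_min_left 1 (Set.mem_Ici.1 hu)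

theorem exists_restrict_Ici_pos {n : Measure ℝ} (h0 : n (Set.Ioi 0) ≠ 0) :
    ∃ ε : ℝ, 0 < ε ∧ 0 < n.restrict (Set.Ioi 0) (Set.Ici ε) := by
  by_contra! h
  refine h0 ?_
  have hU : Set.Ioi (0 : ℝ) ⊆ ⋃ j : ℕ, Set.Ici (1 / ((j : ℝ) + 1)) := fun u hu => by
    obtain ⟨j, hj⟩ := exists_nat_one_div_lt (Set.mem_Ioi.1 hu)
    exact Set.mem_iUnion.2 ⟨j, hj.le⟩
  have h1 : n.restrict (Set.Ioi 0) (⋃ j : ℕ, Set.Ici (1 / ((j : ℝ) + 1))) = 0 :=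
    measure_iUnion_null fun j => nonpos_iff_eq_zero.1 (h _ (by positivity))
  have h2 := measure_mono_null hU h1
  rwa [Measure.restrict_apply_self] at h2

theorem one_sub_exp_neg_le {k : ℕ} {e u : ℝ} (he0 : 0 ≤ e) (he : e ≤ 1) (hu : 0 ≤ u) :
    |1 - Real.exp (-(k * (e * u)))| ≤ (k + 1) * min 1 u := by
  have hz : 0 ≤ (k : ℝ) * (e * u) := by positivity
  have hzu : (k : ℝ) * (e * u) ≤ k * u :=
    mul_le_mul_of_nonneg_left (mul_le_of_le_one_left hu he) (Nat.cast_nonneg k)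
  have h1 : Real.exp (-(k * (e * u))) ≤ 1 := Real.exp_le_one_iff.2 (by linarith)
  have h2 := Real.add_one_le_exp (-(k * (e * u)))
  rw [abs_of_nonneg (by linarith)]
  have hk : (0 : ℝ) ≤ k := Nat.cast_nonneg k
  rcases le_total 1 u with h | h
  · rw [min_eq_left h]; linarith [Real.exp_pos (-(k * (e * u)))]
  · rw [min_eq_right h]; linarith

section Jumps

variable {n : Measure ℝ} {b : ℝ}

theorem ae_prod_pos [SigmaFinite (n.restrict (Set.Ioi 0))] (t : ℝ) :
    ∀ᵐ p ∂((volume.restrict (Set.Ioc 0 t)).prod (n.restrict (Set.Ioi 0))),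
      0 < p.1 ∧ 0 < p.2 := by
  have h : (volume.restrict (Set.Ioc 0 t)).prod (n.restrict (Set.Ioi 0))
      = (volume.prod (n.restrict (Set.Ioi 0))).restrict (Set.Ioc 0 t ×ˢ Set.Ioi 0) := by
    rw [← Measure.prod_restrict, Measure.restrict_restrict measurableSet_Ioi, Set.inter_self]
  rw [h]
  filter_upwards [ae_restrict_mem (measurableSet_Ioc.prod measurableSet_Ioi)] with p hp
  exact ⟨hp.1.1, hp.2⟩

theorem integrable_one_sub_exp [SigmaFinite (n.restrict (Set.Ioi 0))] (hb : 0 ≤ b)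
    (hn : Integrable (fun u : ℝ => min 1 u) (n.restrict (Set.Ioi 0))) (t : ℝ) (k : ℕ) :
    Integrable (fun p : ℝ × ℝ => 1 - Real.exp (-(k * (Real.exp (-(b * p.1)) * p.2))))
      ((volume.restrict (Set.Ioc 0 t)).prod (n.restrict (Set.Ioi 0))) := by
  refine Integrable.mono' ((hn.comp_snd (volume.restrict (Set.Ioc 0 t))).const_mul ((k : ℝ) + 1))
    (by fun_prop) ?_
  filter_upwards [ae_prod_pos t] with p hp
  refine one_sub_exp_neg_le (Real.exp_pos _).le (Real.exp_le_one_iff.2 ?_) hp.2.le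
  have := hp.1
  rw [neg_nonpos]
  positivity

/-- The exponent becomes a drift plus an integral over pairs (age, size), the intensity of a Poisson
family of jumps. -/
theorem integral_immigration [SigmaFinite (n.restrict (Set.Ioi 0))] (a : ℝ) (hb : 0 ≤ b)
    (hn : Integrable (fun u : ℝ => min 1 u) (n.restrict (Set.Ioi 0))) {t : ℝ} (ht : 0 ≤ t)
    (k : ℕ) :
    ∫ s in (0 : ℝ)..t, immigration a n (cumulant b 0 s k)
      = k * (a * ∫ s in (0 : ℝ)..t, Real.exp (-(b * s)))
        + ∫ p : ℝ × ℝ, (1 - Real.exp (-(k * (Real.exp (-(b * p.1)) * p.2))))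
          ∂((volume.restrict (Set.Ioc 0 t)).prod (n.restrict (Set.Ioi 0))) := by
  have hi := integrable_one_sub_exp hb hn t k
  have hfun : ∀ s, immigration a n (cumulant b 0 s k) = k * (a * Real.exp (-(b * s)))
      + ∫ u in Set.Ioi (0 : ℝ), (1 - Real.exp (-(k * (Real.exp (-(b * s)) * u)))) ∂n := by
    intro s
    unfold immigration cumulant
    simp only [zero_mul, add_zero, div_one]
    congr 1
    · ring
    · congr 1; ext u; congr 3; ring
  rw [integral_prod _ hi, intervalIntegral.integral_of_le ht, intervalIntegral.integral_of_le ht]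
  simp only [hfun]
  rw [integral_add _ hi.integral_prod_left, integral_const_mul, integral_const_mul]
  exact Continuous.integrableOn_Ioc (by fun_prop)

theorem exp_neg_pow (z : ℝ) (k : ℕ) : Real.exp (-z) ^ k = Real.exp (-(k * z)) := by
  rw [← Real.exp_nat_mul, mul_neg]

theorem restrict_prod_rect [SigmaFinite (n.restrict (Set.Ioi 0))] {s t : ℝ} (hst : s ≤ t)
    (ε : ℝ) :
    ((volume.restrict (Set.Ioc 0 t)).prod (n.restrict (Set.Ioi 0))).restrict
        (Set.Ioc 0 s ×ˢ Set.Ici ε)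
      = (volume.restrict (Set.Ioc 0 s)).prod ((n.restrict (Set.Ioi 0)).restrict (Set.Ici ε)) := by
  rw [← Measure.prod_restrict, Measure.restrict_restrict measurableSet_Ioc,
    Set.inter_eq_left.2 (Set.Ioc_subset_Ioc_right hst)]

/-- Jumps in the rectangle `S` of ages in `(0,s]` and sizes in `[ε,∞)` do the smoothing; the drift
and the remaining jumps only contribute a factor of norm at most `1`. -/
theorem isMultiplier_of_linear {a : ℝ} {P : ℝ≥0 → Kernel ℝ≥0 ℝ≥0}
    (hb : 0 < b) (ha : 0 ≤ a)
    (hn : ∫⁻ u in Set.Ioi (0 : ℝ), ENNReal.ofReal (min 1 u) ∂n < ∞)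
    (hP : IsTransitionSemigroup b 0 a n P) {ε s t : ℝ} (hε : 0 < ε) (hs : 0 ≤ s) (hst : s ≤ t)
    (x : ℝ≥0) :
    IsMultiplier (fun k => (∫ y : ℝ≥0, Real.exp (-((k : ℝ) * (y : ℝ))) ∂(P t.toNNReal x))
        - ∫ y : ℝ≥0, Real.exp (-((k : ℝ) * (y : ℝ))) ∂(P t.toNNReal 0))
      (2 * Real.exp (-(s * (n.restrict (Set.Ioi 0)).real (Set.Ici ε)))
        + (x * Real.exp (-(b * t))) *
          ((Real.exp (b * s) / (ε * b) + 1 / (ε * b) + 1 / ε * (Real.exp (b * s) * s))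
            * (n.restrict (Set.Ioi 0)).real (Set.Ici ε))) := by
  have ht := hs.trans hst
  have hσ := sigmaFinite_restrict_Ioi hn
  have hmin := integrable_min_one hn
  set N := n.restrict (Set.Ioi 0) with hN
  set m := N.real (Set.Ici ε) with hm
  set ν := (volume.restrict (Set.Ioc 0 t)).prod N with hν
  have hNfin : IsFiniteMeasure (N.restrict (Set.Ici ε)) :=
    ⟨by rw [Measure.restrict_apply_univ]; exact restrict_Ici_lt_top hn hε⟩
  set S : Set (ℝ × ℝ) := Set.Ioc 0 s ×ˢ Set.Ici ε with hS
  have hSm : MeasurableSet S := measurableSet_Ioc.prod measurableSet_Ici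
  have hνS : ν.restrict S = (volume.restrict (Set.Ioc 0 s)).prod (N.restrict (Set.Ici ε)) :=
    restrict_prod_rect hst ε
  have hνSfin : IsFiniteMeasure (ν.restrict S) := by rw [hνS]; infer_instance
  have hmass : (ν.restrict S).real Set.univ = s * m := by
    rw [hνS, ← Set.univ_prod_univ, measureReal_prod_prod, measureReal_restrict_apply_univ,
      measureReal_restrict_apply_univ]
    simp [hs, hm]
  set w : ℝ × ℝ → ℝ := fun p => Real.exp (-(Real.exp (-(b * p.1)) * p.2)) with hw
  have hwm : Measurable w := by fun_prop
  have hwk : ∀ p (k : ℕ), w p ^ k = Real.exp (-(k * (Real.exp (-(b * p.1)) * p.2))) :=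
    fun p k => exp_neg_pow _ k
  have hw01 : ∀ᵐ p ∂ν, w p ∈ Set.Icc (0 : ℝ) 1 := by
    filter_upwards [ae_prod_pos t] with p hp
    refine ⟨(Real.exp_pos _).le, Real.exp_le_one_iff.2 ?_⟩
    have := hp.2
    rw [neg_nonpos]
    positivity
  have hi : ∀ k : ℕ, Integrable (fun p => 1 - w p ^ k) ν := fun k => by
    simpa only [hwk] using integrable_one_sub_exp hb.le hmin t k
  have hwi : ∀ k : ℕ, Integrable (fun p => w p ^ k) (ν.restrict S) := fun k => by
    refine ((integrable_const (μ := ν.restrict S) (1 : ℝ)).sub (hi k).restrict).congr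
      (Eventually.of_forall fun p => ?_)
    simp
  set τ : ℕ → ℝ := fun k => ∫ p in S, w p ^ k ∂ν with hτ
  have hτM : IsMultiplier τ (s * m) := by
    have := IsMultiplier.integral (ν := ν.restrict S) (C := fun p k => w p ^ k) (κ := 1)
      (by filter_upwards [ae_restrict_of_ae (s := S) hw01] with p hp using IsMultiplier.geom hp) hwi
    rwa [hmass, one_mul] at this
  have hkτM : IsMultiplier (fun k => k * τ k)
      ((Real.exp (b * s) / (ε * b) + 1 / (ε * b) + 1 / ε * (Real.exp (b * s) * s)) * m) := by
    have hwi' : ∀ k : ℕ, Integrable (fun p : ℝ × ℝ =>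
        Real.exp (-(k * (Real.exp (-(b * p.1)) * p.2))))
        ((volume.restrict (Set.Ioc 0 s)).prod (N.restrict (Set.Ici ε))) := fun k => by
      simpa only [hwk, hνS] using hwi k
    have := IsMultiplier.integral (ν := N.restrict (Set.Ici ε))
      (C := fun u (k : ℕ) =>
        k * ∫ r in (0 : ℝ)..s, Real.exp (-(k * (Real.exp (-(b * r)) * u))))
      (κ := Real.exp (b * s) / (ε * b) + 1 / (ε * b) + 1 / ε * (Real.exp (b * s) * s))
      (by
        filter_upwards [ae_restrict_mem measurableSet_Ici] with u hu
        exact IsMultiplier.mul_integral_exp_neg hb hε hu hs)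
      (fun k => by
        simp only [intervalIntegral.integral_of_le hs]
        exact (hwi' k).integral_prod_right.const_mul _)
    rw [measureReal_restrict_apply_univ] at this
    convert this using 2 with k
    rw [integral_const_mul]
    simp only [intervalIntegral.integral_of_le hs, hτ, hνS, hwk]
    rw [integral_prod_symm _ (hwi' k)]
  have hz : 0 ≤ a * ∫ r in (0 : ℝ)..t, Real.exp (-(b * r)) :=
    mul_nonneg ha (intervalIntegral.integral_nonneg ht fun r _ => (Real.exp_pos _).le)
  -- Here the parameter `ε` of the lemma is the shift `x e^{-bt}`, not the jump cutoff.
  have h1 := IsMultiplier.exp_sub_one_mul_exp (ε := x * Real.exp (-(b * t))) (by positivity)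
    (mul_nonneg hs measureReal_nonneg) hτM hkτM
  have h2 := (IsMultiplier.exp_neg_mul hz).mul
    (IsMultiplier.exp_neg_integral (ν := ν.restrict Sᶜ) hwm (ae_restrict_of_ae (s := Sᶜ) hw01)
      fun k => (hi k).restrict)
  convert h1.mul h2 using 1
  · ext k
    rw [hP.integral_exp_sub ht, integral_immigration a hb.le hmin ht]
    simp only [← hN, ← hν, ← hwk]
    rw [← integral_add_compl hSm (hi k), integral_sub (μ := ν.restrict S) (integrable_const _) (hwi k),
      integral_const, hmass, mul_assoc, ← Real.exp_add, ← Real.exp_add]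
    congr 2
    · unfold cumulant
      simp only [zero_mul, add_zero, div_one]
      ring_nf
    · simp only [hτ, smul_eq_mul, mul_one]
      ring
  · ring

end Jumps

/-! ### Merging of the transition laws as `t → ∞`. -/

section Merging

variable {b c a : ℝ} {n : Measure ℝ} {P : ℝ≥0 → Kernel ℝ≥0 ℝ≥0}

theorem eventually_isMultiplier_of_pos (hb : 0 ≤ b) (hc : 0 < c)
    (hP : IsTransitionSemigroup b c a n P) (x : ℝ≥0) {δ : ℝ} (hδ : 0 < δ) :
    ∀ᶠ t : ℝ in atTop, IsMultiplier
      (fun k => (∫ y : ℝ≥0, Real.exp (-((k : ℝ) * (y : ℝ))) ∂(P t.toNNReal x))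
        - ∫ y : ℝ≥0, Real.exp (-((k : ℝ) * (y : ℝ))) ∂(P t.toNNReal 0)) δ := by
  have h1 : Tendsto (fun t : ℝ => 2 * ((x : ℝ) / (c * t))) atTop (𝓝 (2 * 0)) :=
    ((tendsto_id.const_mul_atTop hc).const_div_atTop _).const_mul 2
  rw [mul_zero] at h1
  have h2 := h1.mul ((Real.continuous_exp.tendsto 0).comp h1)
  rw [zero_mul] at h2
  filter_upwards [eventually_gt_atTop 0, h2.eventually_lt_const hδ] with t ht htδ
  exact (isMultiplier_of_pos hb hc hP ht x).mono htδ.le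

theorem eventually_isMultiplier_of_linear (hb : 0 < b) (ha : 0 ≤ a)
    (hn : ∫⁻ u in Set.Ioi (0 : ℝ), ENNReal.ofReal (min 1 u) ∂n < ∞) (h0 : n (Set.Ioi 0) ≠ 0)
    (hP : IsTransitionSemigroup b 0 a n P) (x : ℝ≥0) {δ : ℝ} (hδ : 0 < δ) :
    ∀ᶠ t : ℝ in atTop, IsMultiplier
      (fun k => (∫ y : ℝ≥0, Real.exp (-((k : ℝ) * (y : ℝ))) ∂(P t.toNNReal x))
        - ∫ y : ℝ≥0, Real.exp (-((k : ℝ) * (y : ℝ))) ∂(P t.toNNReal 0)) δ := by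
  obtain ⟨ε, hε, hpos⟩ := exists_restrict_Ici_pos h0
  have hm : 0 < (n.restrict (Set.Ioi 0)).real (Set.Ici ε) :=
    ENNReal.toReal_pos hpos.ne' (restrict_Ici_lt_top hn hε).ne
  have hs : Tendsto (fun s : ℝ =>
      2 * Real.exp (-(s * (n.restrict (Set.Ioi 0)).real (Set.Ici ε)))) atTop (𝓝 (2 * 0)) :=
    (Real.tendsto_exp_neg_atTop_nhds_zero.comp (tendsto_id.atTop_mul_const hm)).const_mul 2
  rw [mul_zero] at hs
  -- The window `s` is fixed first, to make a jump likely; its large constant is then beaten by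
  -- `e^{-bt}`.
  obtain ⟨s, hs0, hsδ⟩ := ((eventually_ge_atTop 0).and
    (hs.eventually_lt_const (half_pos hδ))).exists
  have ht : Tendsto (fun t : ℝ => ((x : ℝ) * Real.exp (-(b * t))) *
      ((Real.exp (b * s) / (ε * b) + 1 / (ε * b) + 1 / ε * (Real.exp (b * s) * s))
        * (n.restrict (Set.Ioi 0)).real (Set.Ici ε))) atTop (𝓝 (((x : ℝ) * 0) *
      ((Real.exp (b * s) / (ε * b) + 1 / (ε * b) + 1 / ε * (Real.exp (b * s) * s))
        * (n.restrict (Set.Ioi 0)).real (Set.Ici ε)))) :=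
    ((Real.tendsto_exp_neg_atTop_nhds_zero.comp
      (tendsto_id.const_mul_atTop hb)).const_mul _).mul_const _
  rw [mul_zero, zero_mul] at ht
  filter_upwards [eventually_ge_atTop s, ht.eventually_lt_const (half_pos hδ)] with t hst htδ
  refine (isMultiplier_of_linear hb ha hn hP hε hs0 hst x).mono ?_
  linarith

theorem tendsto_integral_sub (hP : ∀ t, IsMarkovKernel (P t))
    (hM : ∀ (x : ℝ≥0) (δ : ℝ), 0 < δ → ∀ᶠ t : ℝ in atTop, IsMultiplier
      (fun k => (∫ y : ℝ≥0, Real.exp (-((k : ℝ) * (y : ℝ))) ∂(P t.toNNReal x))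
        - ∫ y : ℝ≥0, Real.exp (-((k : ℝ) * (y : ℝ))) ∂(P t.toNNReal 0)) δ)
    (x y : ℝ≥0) {h : ℝ → ℝ≥0 → ℝ} (hm : ∀ t, Measurable (h t)) (h1 : ∀ t z, |h t z| ≤ 1) :
    Tendsto (fun t => ∫ z, h t z ∂P t.toNNReal x - ∫ z, h t z ∂P t.toNNReal y)
      atTop (𝓝 0) := by
  have key : ∀ x : ℝ≥0, Tendsto
      (fun t => ∫ z, h t z ∂P t.toNNReal x - ∫ z, h t z ∂P t.toNNReal 0) atTop (𝓝 0) := by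
    intro x
    rw [Metric.tendsto_nhds]
    intro δ hδ
    filter_upwards [hM x (δ / 2) (half_pos hδ)] with t ht
    have := ht.abs_integral_sub_le (hm t) (h1 t)
    rw [Real.dist_eq, sub_zero]
    linarith
  simpa using (key x).sub (key y)

end Merging

/-! ### No jumps and no branching noise: the stationary law is degenerate. -/

section Deterministic

variable {Ω : Type*} [MeasurableSpace Ω] {μ : Measure Ω} [IsProbabilityMeasure μ]
  {b c a : ℝ} {n : Measure ℝ} {P : ℝ≥0 → Kernel ℝ≥0 ℝ≥0} {η : Measure ℝ≥0}
  [IsProbabilityMeasure η] {Y : ℝ → Ω → ℝ≥0}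

theorem integrable_exp_neg_mul (ν : Measure ℝ≥0) [IsFiniteMeasure ν] {l : ℝ} (hl : 0 ≤ l) :
    Integrable (fun z : ℝ≥0 => Real.exp (-(l * (z : ℝ)))) ν := by
  refine integrable_of_abs_le_one (by fun_prop) fun z => ?_
  rw [abs_of_pos (Real.exp_pos _), Real.exp_le_one_iff, neg_nonpos]
  positivity

theorem HasPathLaw.integral_integral_kernel (hY : HasPathLaw μ P η Y)
    (hP : ∀ t, IsMarkovKernel (P t)) {t : ℝ} (ht : 0 < t) {l : ℝ} (hl : 0 ≤ l) :
    ∫ x, ∫ z : ℝ≥0, Real.exp (-(l * (z : ℝ))) ∂P t.toNNReal x ∂η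
      = ∫ z : ℝ≥0, Real.exp (-(l * (z : ℝ))) ∂η := by
  have hPt := hP t.toNNReal
  have hm := hY.measurable
  have hbind : η.bind (P t.toNNReal) = η := by
    ext D hD
    have h := hY.markov hP ht (A := Set.univ) (@MeasurableSet.univ _ (sigmaOf Y _)) hD
    rw [Set.univ_inter, sub_zero, Measure.restrict_univ, ← Measure.map_apply (hm t) hD,
      hY.map_apply_eq] at h
    rw [h, Measure.bind_apply hD (Kernel.aemeasurable _), ← hY.map_apply_eq 0,
      lintegral_map (Kernel.measurable_coe _ hD) (hm 0)]
  have hcomp : (P t.toNNReal ∘ₖ Kernel.const Unit η) () = η := by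
    rw [Kernel.comp_apply, Kernel.const_apply, hbind]
  have h := Kernel.integral_comp (η := P t.toNNReal) (κ := Kernel.const Unit η) (a := ())
    (f := fun z : ℝ≥0 => Real.exp (-(l * (z : ℝ))))
    (by rw [hcomp]; exact integrable_exp_neg_mul η hl)
  rw [hcomp, Kernel.const_apply] at h
  exact h.symm

theorem discount_eq_integral (b t : ℝ) :
    ∫ s in (0 : ℝ)..t, Real.exp (-(b * s)) = discount b t := by
  rw [intervalIntegral.integral_eq_sub_of_hasDerivAt (f := discount b)
    (fun s _ => discount_hasDerivAt b s) (Continuous.intervalIntegrable (by fun_prop) _ _)]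
  simp [discount]

theorem tendsto_discount (hb : 0 < b) : Tendsto (discount b) atTop (𝓝 (1 / b)) := by
  have h : Tendsto (fun t : ℝ => (1 - Real.exp (-(b * t))) / b) atTop (𝓝 ((1 - 0) / b)) :=
    ((Real.tendsto_exp_neg_atTop_nhds_zero.comp
      (tendsto_id.const_mul_atTop hb)).const_sub 1).div_const b
  rw [sub_zero] at h
  refine h.congr fun t => ?_
  simp [discount, hb.ne']

/-- Invariance of `η` under `P_t` expresses the left side through `t`; as `t → ∞` the starting point
is forgotten and only the limiting drift `a/b` remains. -/
theorem HasPathLaw.integral_exp_of_no_jumps (hY : HasPathLaw μ P η Y) (hb : 0 < b)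
    (h0 : n (Set.Ioi 0) = 0) (hP : IsTransitionSemigroup b 0 a n P) (k : ℕ) :
    ∫ z : ℝ≥0, Real.exp (-((k : ℝ) * (z : ℝ))) ∂η = Real.exp (-(k * (a * (1 / b)))) := by
  have hE : ∀ t : ℝ, ∫ s in (0 : ℝ)..t, immigration a n (cumulant b 0 s k)
      = k * (a * discount b t) := by
    intro t
    rw [← discount_eq_integral, ← intervalIntegral.integral_const_mul,
      ← intervalIntegral.integral_const_mul]
    congr 1
    ext s
    simp only [immigration, cumulant, Measure.restrict_eq_zero.2 h0, integral_zero_measure]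
    simp only [zero_mul, add_zero, div_one]
    ring
  have heq : ∀ t : ℝ, 0 < t → ∫ z : ℝ≥0, Real.exp (-((k : ℝ) * (z : ℝ))) ∂η
      = ∫ x : ℝ≥0, Real.exp (-((x : ℝ) * (Real.exp (-(b * t)) * k)))
        * Real.exp (-(k * (a * discount b t))) ∂η := by
    intro t ht
    rw [← hY.integral_integral_kernel hP.isMarkovKernel ht (Nat.cast_nonneg k)]
    refine integral_congr_ae (Eventually.of_forall fun x => ?_)
    simp only [hP.integral_exp ht.le, hE]
    simp [cumulant]
  have hlim : Tendsto (fun t : ℝ => ∫ x : ℝ≥0, Real.exp (-((x : ℝ) * (Real.exp (-(b * t)) * k)))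
        * Real.exp (-(k * (a * discount b t))) ∂η) atTop
      (𝓝 (Real.exp (-(k * (a * (1 / b)))))) := by
    simp only [integral_mul_const]
    have h1 : Tendsto (fun t : ℝ => ∫ x : ℝ≥0, Real.exp (-((x : ℝ) * (Real.exp (-(b * t)) * k))) ∂η)
        atTop (𝓝 (∫ _ : ℝ≥0, (1 : ℝ) ∂η)) := by
      refine tendsto_integral_filter_of_dominated_convergence (fun _ => 1)
        (Eventually.of_forall fun t => ?_) (Eventually.of_forall fun t => Eventually.of_forall
          fun x => ?_) (integrable_const _) (Eventually.of_forall fun x => ?_)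
      · have : Measurable fun x : ℝ≥0 => Real.exp (-((x : ℝ) * (Real.exp (-(b * t)) * k))) := by
          fun_prop
        exact this.aestronglyMeasurable
      · rw [Real.norm_of_nonneg (Real.exp_pos _).le, Real.exp_le_one_iff, neg_nonpos]
        positivity
      · have h2 : Tendsto (fun t : ℝ => Real.exp (-(b * t))) atTop (𝓝 0) :=
          Real.tendsto_exp_neg_atTop_nhds_zero.comp (tendsto_id.const_mul_atTop hb)
        have h3 := (Real.continuous_exp.tendsto _).comp ((h2.mul_const (k : ℝ)).const_mul (x : ℝ)).neg
        simpa [Function.comp_def] using h3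
    have h4 : Tendsto (fun t : ℝ => Real.exp (-(k * (a * discount b t)))) atTop
        (𝓝 (Real.exp (-(k * (a * (1 / b)))))) :=
      (Real.continuous_exp.tendsto _).comp (((tendsto_discount hb).const_mul a).const_mul (k : ℝ)).neg
    simpa using h1.mul h4
  refine tendsto_nhds_unique (tendsto_const_nhds.congr' ?_) hlim
  filter_upwards [eventually_gt_atTop 0] with t ht using heq t ht

/-- Without jumps of the immigration and without branching noise, the stationary law is a point
mass. -/
theorem HasPathLaw.ae_eq_of_no_jumps (hY : HasPathLaw μ P η Y) (hb : 0 < b)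
    (h0 : n (Set.Ioi 0) = 0) (hP : IsTransitionSemigroup b 0 a n P) :
    ∀ᵐ p ∂(η.prod η), p.1 = p.2 := by
  set q := Real.exp (-(a * (1 / b))) with hq
  -- The transforms at `1` and `2` show that `e^{-z}` has mean `q` and second moment `q²` under `η`,
  -- hence variance zero.
  have e1 := hY.integral_exp_of_no_jumps hb h0 hP 1
  have e2 := hY.integral_exp_of_no_jumps hb h0 hP 2
  have hq2 : Real.exp (-(((2 : ℕ) : ℝ) * (a * (1 / b)))) = q ^ 2 := by
    rw [hq, ← Real.exp_nat_mul]; congr 1; push_cast; ring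
  rw [hq2] at e2
  simp only [Nat.cast_one, one_mul] at e1
  have hi1 := integrable_exp_neg_mul η zero_le_one
  have hi2 := integrable_exp_neg_mul η (Nat.cast_nonneg 2)
  simp only [one_mul] at hi1
  have hsq : ∀ z : ℝ≥0, (Real.exp (-(z : ℝ)) - q) ^ 2
      = Real.exp (-(((2 : ℕ) : ℝ) * (z : ℝ))) - 2 * q * Real.exp (-(z : ℝ)) + q ^ 2 := by
    intro z
    have : Real.exp (-(((2 : ℕ) : ℝ) * (z : ℝ))) = Real.exp (-(z : ℝ)) ^ 2 := by
      rw [← Real.exp_nat_mul]; congr 1; ring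
    rw [this]; ring
  have hint : Integrable (fun z : ℝ≥0 => (Real.exp (-(z : ℝ)) - q) ^ 2) η := by
    simp only [hsq]
    exact (hi2.sub (hi1.const_mul _)).add (integrable_const _)
  have hzero : ∫ z : ℝ≥0, (Real.exp (-(z : ℝ)) - q) ^ 2 ∂η = 0 := by
    have hi3 : Integrable (fun z : ℝ≥0 => Real.exp (-(((2 : ℕ) : ℝ) * (z : ℝ)))
        - 2 * q * Real.exp (-(z : ℝ))) η := hi2.sub (hi1.const_mul _)
    simp only [hsq]
    rw [integral_add hi3 (integrable_const _), integral_sub hi2 (hi1.const_mul _), integral_const_mul, e1, e2, ← hq,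
      integral_const, probReal_univ, smul_eq_mul]
    ring
  have hae := (integral_eq_zero_iff_of_nonneg (fun z => sq_nonneg _) hint).1 hzero
  filter_upwards [Measure.quasiMeasurePreserving_fst.ae hae,
    Measure.quasiMeasurePreserving_snd.ae hae] with p hp1 hp2
  have h1 := sub_eq_zero.1 (pow_eq_zero_iff two_ne_zero |>.1 hp1)
  have h2 := sub_eq_zero.1 (pow_eq_zero_iff two_ne_zero |>.1 hp2)
  exact NNReal.coe_injective (neg_injective (Real.exp_injective (h1.trans h2.symm)))

end Deterministic

end CBI

theorem theorem2p2 {Ω : Type*} [MeasurableSpace Ω] (μ : Measure Ω) [IsProbabilityMeasure μ]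
    (b c a : ℝ) (hb : 0 ≤ b) (hc : 0 ≤ c) (ha : 0 ≤ a)
    (n : Measure ℝ) (hn : ∫⁻ u in Set.Ioi (0 : ℝ), ENNReal.ofReal (min 1 u) ∂n < ∞)
    (hφ : ∀ z : ℝ, 0 < z → CBI.branching b c z ≠ 0)
    (hψ : ∃ l : ℝ, 0 < l ∧
      IntegrableOn (fun z => CBI.immigration a n z / CBI.branching b c z) (Set.Ioc 0 l))
    (P : ℝ≥0 → Kernel ℝ≥0 ℝ≥0) (hP : CBI.IsTransitionSemigroup b c a n P)
    (η : Measure ℝ≥0) [IsProbabilityMeasure η]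
    (Y : ℝ → Ω → ℝ≥0) (hY : CBI.HasPathLaw μ P η Y) :
    Tendsto (fun t : ℝ => CBI.mixingCoeff μ Y t) atTop (𝓝 0) := by
  refine hY.tendsto_mixingCoeff hP.isMarkovKernel ?_
  rcases hc.lt_or_eq with hc | rfl
  · exact Eventually.of_forall fun p h hm h1 => CBI.tendsto_integral_sub hP.isMarkovKernel
      (fun x _ hδ => CBI.eventually_isMultiplier_of_pos hb hc hP x hδ) p.1 p.2 hm h1
  · have hb' : 0 < b := by
      refine lt_of_le_of_ne hb fun h => hφ 1 one_pos ?_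
      simp [CBI.branching, ← h]
    -- Without jumps the laws from distinct points are distinct point masses and never merge, so
    -- only the almost sure form of the criterion can apply.
    by_cases h0 : n (Set.Ioi 0) = 0
    · filter_upwards [hY.ae_eq_of_no_jumps hb' h0 hP] with p hp h _ _
      simp [hp]
    · exact Eventually.of_forall fun p h hm h1 => CBI.tendsto_integral_sub hP.isMarkovKernel
        (fun x _ hδ => CBI.eventually_isMultiplier_of_linear hb' ha hn h0 hP x hδ) p.1 p.2 hm h1
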